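/- For $c\in\mathbb R^k$ let $\Phi(c)\in\mathbb R^{k\times k}$ be the companion matrix with ones on the superdiagonal, last row $(-c_1,\dots,-c_k)$ and zeros elsewhere. Let $\Gamma=[1\;0\cdots 0]\in\mathbb R^{1\times n}$, let $N=[0\cdots 0\;1]^\top\in\mathbb R^{2n}$, and for $\theta\in\mathbb R^{2n}$ let $\Theta(\theta)\in\mathbb R^{n\times n}$ be the Hankel matrix with $(i,j)$ entry $\theta_{i+j-1}$. A real matrix is Hurwitz if all its eigenvalues have negative real part. Consider the SISO plant $$\dot x=Ax+Bu+Pv,\qquad e=Cx+Du+Fv,\qquad x\in\mathbb R^{n_x},\ u,e\in\mathbb R,$$ driven by the exosystem $\dot v=\Phi(a(\sigma))v$, $y_0=\Gamma v$, $v\in\mathbb R^n$, where $\sigma\in\mathbb S\subseteq\mathbb R^{n_\sigma}$ is unknown. Assume that 1. for every $\sigma\in\mathbb S$ the eigenvalues of $\Phi(a(\sigma))$ are distinct and have zero real part; 2. $(A,B)$ is stabilizable, i.e. $A+BK$ is Hurwitz for some $K$; 3. for every $\sigma\in\mathbb S$ the regulator equations $X\Phi(a(\sigma))=AX+BU+P$,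 $0=CX+DU+F$ have a solution $(X,U)$. Take $k_1,k_2>0$, $m\in\mathbb R^{2n}$ such that $M=\Phi(m)\in\mathbb R^{2n\times 2n}$ is Hurwitz, and $K_x$ such that $A+BK_x$ is Hurwitz. With $\Xi(\hat a)=\Phi(\hat a)^{2n}+\sum_{j=1}^{2n}m_j\Phi(\hat a)^{j-1}$, consider the control law $$\dot\eta=M\eta+Ny_0,\qquad \dot{\hat a}=-k_1\Theta(\eta)^\top\big[\Theta(\eta)\hat a+\mathrm{col}(\eta_{n+1},\dots,\eta_{2n})\big],$$ $$\dot{\hat\zeta}=-k_2\mathcal A(\hat a)^\top\big(\mathcal A(\hat a)\hat\zeta-\mathcal B\big),\qquad u=K_xx+(\hat U-K_x\hat X)\,\Xi(\hat a)\,\mathrm{col}(\eta_1,\dots,\eta_n),$$ where $\eta\in\mathbb R^{2n}$, $\hat a\in\mathbb R^n$, $\hat\zeta=\mathrm{vec}\,\mathrm{col}(\hat X,\hat U)$ (columns stacked), $\mathcal B=\mathrm{vec}\,\mathrm{col}(P,F)$ and $$\mathcal A(\hat a)=\Phi(\hat a)^\top\otimes\begin{bmatrix}I_{n_x}&0\\0&0\end{bmatrix}-I_n\otimes\begin{bmatrix}A&B\\C&D\end{bmatrix}.$$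 Then for all $k_1,k_2>0$ such $m$ and $K_x$ exist, and every such choice solves the output regulation problem, in the following sense. For every $\sigma\in\mathbb S$ and all initial values $v(0),x(0),\eta(0),\hat a(0),\hat\zeta(0)$, the closed-loop system has a solution on $[0,\infty)$. Moreover, for every closed-loop solution on $[0,\infty)$ for which the exosystem output is a multi-tone signal $$y_0(t)=d_0+\sum_{k=1}^{q}d_k\sin(\omega_kt+\phi_k),\qquad t\ge 0,$$ with all $d_k\ne0$ and pairwise distinct $\omega_k>0$, where $n=2q$ if $d_0=0$ and $n=2q+1$ if $d_0\neq0$, the state $(v,x,\eta,\hat a,\hat\zeta)$ is bounded on $[0,\infty)$ and $\lim_{t\to\infty}e(t)=0$. -/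

import Mathlib

open Matrix Filter Topology Set
open scoped Kronecker

namespace FeedforwardRegulation

/-- A real square matrix is Hurwitz if all its complex eigenvalues have negative real part. -/
def IsHurwitz {ι : Type} [Fintype ι] [DecidableEq ι] (A : Matrix ι ι ℝ) : Prop :=
  ∀ z ∈ spectrum ℂ (A.map (algebraMap ℝ ℂ)), z.re < 0

/-- The pair `(A, B)` is stabilizable: some state feedback makes `A + B K` Hurwitz. -/
def IsStabilizable {nx nu : ℕ} (A : Matrix (Fin nx) (Fin nx) ℝ)
    (B : Matrix (Fin nx) (Fin nu) ℝ) : Prop :=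
  ∃ K : Matrix (Fin nu) (Fin nx) ℝ, IsHurwitz (A + B * K)

/-- The eigenvalues of `A`, as roots of its characteristic polynomial over `ℂ`, are pairwise
distinct and have zero real part. -/
def HasDistinctImaginaryEigenvalues {k : ℕ} (A : Matrix (Fin k) (Fin k) ℝ) : Prop :=
  (A.map (algebraMap ℝ ℂ)).charpoly.roots.Nodup ∧
    ∀ z ∈ (A.map (algebraMap ℝ ℂ)).charpoly.roots, z.re = 0

/-- The `k × k` companion matrix with ones on the superdiagonal and last row
`-c₁, …, -c_k`; its characteristic polynomial is `ς^k + c_k ς^(k-1) + ⋯ + c₂ ς + c₁`. -/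
def companion {k : ℕ} (c : Fin k → ℝ) : Matrix (Fin k) (Fin k) ℝ :=
  Matrix.of fun i j =>
    if i.val + 1 = k then -c j else if j.val = i.val + 1 then 1 else 0

/-- `Γ = [1 0 ⋯ 0]`. -/
def Gam (n : ℕ) : Matrix (Fin 1) (Fin n) ℝ :=
  Matrix.of fun _ j => if j.val = 0 then 1 else 0

/-- `N = [0 ⋯ 0 1]ᵀ`, a column of length `2n`. -/
def Nvec (n : ℕ) : Matrix (Fin (2 * n)) (Fin 1) ℝ :=
  Matrix.of fun i _ => if i.val + 1 = 2 * n then 1 else 0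

/-- `Ξ(a) = Φ(a)^(2n) + ∑_{j=1}^{2n} m_j Φ(a)^(j-1)`, where `Φ(a)` is the companion matrix. -/
def Xi {n : ℕ} (m : Fin (2 * n) → ℝ) (a : Fin n → ℝ) : Matrix (Fin n) (Fin n) ℝ :=
  companion a ^ (2 * n) + ∑ j : Fin (2 * n), m j • companion a ^ j.val

/-- The Hankel matrix `Θ(θ)` with entries `θ_{i+j-1}`, `1 ≤ i, j ≤ n`. -/
def Hankel {n : ℕ} (θ : Fin (2 * n) → ℝ) : Matrix (Fin n) (Fin n) ℝ :=
  Matrix.of fun i j => θ ⟨i.val + j.val, by omega⟩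

/-- `col(η₁, …, η_n)`. -/
def upper {n : ℕ} (η : Fin (2 * n) → ℝ) : Fin n → ℝ := fun i => η ⟨i.val, by omega⟩

/-- `col(η_{n+1}, …, η_{2n})`. -/
def lower {n : ℕ} (η : Fin (2 * n) → ℝ) : Fin n → ℝ := fun i => η ⟨n + i.val, by omega⟩

/-- The matrices of the single-input single-output plant
`ẋ = A x + B u + P v`, `e = C x + D u + F v`. -/
structure Plant (nx n : ℕ) where
  A : Matrix (Fin nx) (Fin nx) ℝ
  B : Matrix (Fin nx) (Fin 1) ℝ
  P : Matrix (Fin nx) (Fin n) ℝ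
  C : Matrix (Fin 1) (Fin nx) ℝ
  D : Matrix (Fin 1) (Fin 1) ℝ
  F : Matrix (Fin 1) (Fin n) ℝ

/-- `(X, U)` solves `X Φ(a) = A X + B U + P`, `0 = C X + D U + F`. -/
def Plant.IsRegulatorSolution {nx n : ℕ} (p : Plant nx n) (a : Fin n → ℝ)
    (X : Matrix (Fin nx) (Fin n) ℝ) (U : Matrix (Fin 1) (Fin n) ℝ) : Prop :=
  X * companion a = p.A * X + p.B * U + p.P ∧ 0 = p.C * X + p.D * U + p.F

/-- `Φ(a)ᵀ ⊗ diag(I, 0) - I ⊗ [A B; C D]`, the coefficient matrix of the vectorized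
regulator equations. -/
def Plant.regulatorMatrix {nx n : ℕ} (p : Plant nx n) (a : Fin n → ℝ) :
    Matrix (Fin n × (Fin nx ⊕ Fin 1)) (Fin n × (Fin nx ⊕ Fin 1)) ℝ :=
  (companion a)ᵀ ⊗ₖ
      (Matrix.fromBlocks 1 0 0 0 : Matrix (Fin nx ⊕ Fin 1) (Fin nx ⊕ Fin 1) ℝ) -
    (1 : Matrix (Fin n) (Fin n) ℝ) ⊗ₖ Matrix.fromBlocks p.A p.B p.C p.D

/-- `vec(col(P, F))`, columns stacked. -/
def Plant.regulatorVector {nx n : ℕ} (p : Plant nx n) : Fin n × (Fin nx ⊕ Fin 1) → ℝ :=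
  Matrix.vec (Matrix.fromRows p.P p.F)

/-- The block `X̂` of the matrix `col(X̂, Û)` whose vectorization is `ζ`. -/
def Xhat {nx n : ℕ} (ζ : Fin n × (Fin nx ⊕ Fin 1) → ℝ) : Matrix (Fin nx) (Fin n) ℝ :=
  Matrix.of fun i j => ζ (j, Sum.inl i)

/-- The block `Û` of the matrix `col(X̂, Û)` whose vectorization is `ζ`. -/
def Uhat {nx n : ℕ} (ζ : Fin n × (Fin nx ⊕ Fin 1) → ℝ) : Matrix (Fin 1) (Fin n) ℝ :=
  Matrix.of fun i j => ζ (j, Sum.inr i)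

/-- The design parameters of the feedforward law: the last row of the observer matrix, the
state feedback gain and the two adaptation gains. -/
structure Design (nx n : ℕ) where
  m : Fin (2 * n) → ℝ
  Kx : Matrix (Fin 1) (Fin nx) ℝ
  k₁ : ℝ
  k₂ : ℝ

/-- The design parameters are admissible for the plant. -/
structure Design.IsAdmissible {nx n : ℕ} (g : Design nx n) (p : Plant nx n) : Prop where
  observer : IsHurwitz (companion g.m)
  feedback : IsHurwitz (p.A + p.B * g.Kx)
  k₁_pos : 0 < g.k₁
  k₂_pos : 0 < g.k₂

/-- `u = K_x x + (Û - K_x X̂) Ξ(â) col(η₁, …, η_n)`. -/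
def Design.input {nx n : ℕ} (g : Design nx n) (x : Fin nx → ℝ) (η : Fin (2 * n) → ℝ)
    (ahat : Fin n → ℝ) (ζ : Fin n × (Fin nx ⊕ Fin 1) → ℝ) : Fin 1 → ℝ :=
  g.Kx *ᵥ x + ((Uhat ζ - g.Kx * Xhat ζ) * Xi g.m ahat) *ᵥ upper η

/-- Time signals of all the state variables of the closed loop. -/
structure Signals (nx n : ℕ) where
  v : ℝ → Fin n → ℝ
  x : ℝ → Fin nx → ℝ
  η : ℝ → Fin (2 * n) → ℝ
  ahat : ℝ → Fin n → ℝ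
  ζ : ℝ → Fin n × (Fin nx ⊕ Fin 1) → ℝ

/-- The control input along the signals. -/
def Signals.u {nx n : ℕ} (s : Signals nx n) (g : Design nx n) (t : ℝ) : Fin 1 → ℝ :=
  g.input (s.x t) (s.η t) (s.ahat t) (s.ζ t)

/-- The tracking error `e = C x + D u + F v` along the signals. -/
def Signals.e {nx n : ℕ} (s : Signals nx n) (p : Plant nx n) (g : Design nx n) (t : ℝ) :
    Fin 1 → ℝ :=
  p.C *ᵥ s.x t + p.D *ᵥ s.u g t + p.F *ᵥ s.v t

/-- The exosystem output `y₀ = Γ v` along the signals. -/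
def Signals.y₀ {nx n : ℕ} (s : Signals nx n) (t : ℝ) : Fin 1 → ℝ := Gam n *ᵥ s.v t

/-- The signals solve the closed-loop equations on `[0, ∞)`, where `a` is the true (unknown)
parameter of the exosystem. The control law itself does not involve `a`. -/
structure Signals.IsClosedLoopSolution {nx n : ℕ} (s : Signals nx n) (p : Plant nx n)
    (g : Design nx n) (a : Fin n → ℝ) : Prop where
  exosystem : ∀ t ∈ Ici (0 : ℝ), HasDerivWithinAt s.v (companion a *ᵥ s.v t) (Ici 0) t
  plant : ∀ t ∈ Ici (0 : ℝ),
    HasDerivWithinAt s.x (p.A *ᵥ s.x t + p.B *ᵥ s.u g t + p.P *ᵥ s.v t) (Ici 0) t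
  observer : ∀ t ∈ Ici (0 : ℝ),
    HasDerivWithinAt s.η (companion g.m *ᵥ s.η t + Nvec n *ᵥ s.y₀ t) (Ici 0) t
  parameter : ∀ t ∈ Ici (0 : ℝ),
    HasDerivWithinAt s.ahat
      (-g.k₁ • ((Hankel (s.η t))ᵀ *ᵥ (Hankel (s.η t) *ᵥ s.ahat t + lower (s.η t)))) (Ici 0) t
  regulator : ∀ t ∈ Ici (0 : ℝ),
    HasDerivWithinAt s.ζ
      (-g.k₂ • ((p.regulatorMatrix (s.ahat t))ᵀ *ᵥ
        (p.regulatorMatrix (s.ahat t) *ᵥ s.ζ t - p.regulatorVector))) (Ici 0) t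

/-- All state variables are bounded on `[0, ∞)`. -/
def Signals.IsBounded {nx n : ℕ} (s : Signals nx n) : Prop :=
  ∃ c : ℝ, ∀ t ∈ Ici (0 : ℝ),
    ‖s.v t‖ ≤ c ∧ ‖s.x t‖ ≤ c ∧ ‖s.η t‖ ≤ c ∧ ‖s.ahat t‖ ≤ c ∧ ‖s.ζ t‖ ≤ c

/-- `y` is, for `t ≥ 0`, a multi-tone signal `d₀ + ∑ d_k sin(ω_k t + φ_k)` with nonzero
amplitudes and `q` distinct positive frequencies, where `n = 2q` if `d₀ = 0` and `n = 2q + 1`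
if `d₀ ≠ 0`. -/
def IsMultiTone (n : ℕ) (y : ℝ → Fin 1 → ℝ) : Prop :=
  ∃ (q : ℕ) (d₀ : ℝ) (d ω φ : Fin q → ℝ),
    (∀ k, d k ≠ 0) ∧ (∀ k, 0 < ω k) ∧ Function.Injective ω ∧
    ((n = 2 * q ∧ d₀ = 0) ∨ (n = 2 * q + 1 ∧ d₀ ≠ 0)) ∧
    ∀ t ∈ Ici (0 : ℝ), y t 0 = d₀ + ∑ k, d k * Real.sin (ω k * t + φ k)

/-- The feedforward law with design parameters `g` solves the output regulation problem for
every exosystem parameter `a σ`, `σ ∈ S`: from all initial states the closed-loop solution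
exists on `[0, ∞)`, and if the exosystem output is multi-tone, then the solution is bounded
and the tracking error tends to zero. -/
def SolvesOutputRegulation {nx n r : ℕ} (p : Plant nx n) (g : Design nx n)
    (S : Set (Fin r → ℝ)) (a : (Fin r → ℝ) → Fin n → ℝ) : Prop :=
  ∀ σ ∈ S,
    (∀ (v₀ : Fin n → ℝ) (x₀ : Fin nx → ℝ) (η₀ : Fin (2 * n) → ℝ) (a₀ : Fin n → ℝ)
        (ζ₀ : Fin n × (Fin nx ⊕ Fin 1) → ℝ),
      ∃ s : Signals nx n, s.IsClosedLoopSolution p g (a σ) ∧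
        s.v 0 = v₀ ∧ s.x 0 = x₀ ∧ s.η 0 = η₀ ∧ s.ahat 0 = a₀ ∧ s.ζ 0 = ζ₀) ∧
    ∀ s : Signals nx n, s.IsClosedLoopSolution p g (a σ) → IsMultiTone n s.y₀ →
      s.IsBounded ∧ Tendsto (s.e p g) atTop (𝓝 0)

end FeedforwardRegulation

/-! The closed loop is a cascade `v`, `η`, `ahat`, `ζ`, `x`: each equation is affine in its own
state, with coefficients that depend continuously on the earlier states. Global existence therefore
reduces to linear equations with continuous coefficients (`exists_linearODE`).

For regulation, write the multi-tone output as `∑ c_k exp (λ_k t)` with `n` distinct imaginary `λ_k`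
and nonzero `c_k`. The exosystem is the scalar equation `a(d/dt) y₀ = 0`, so every `λ_k` is a root
of the polynomial `a`. The observer is the scalar equation `m(d/dt) η₁ = y₀`, so it has a steady
state `θ` with amplitudes `c_k / m(λ_k)`. Along `θ` the true `a` solves the Hankel equation, and
`Ξ(a)`, which multiplies the `k`-th mode by `m(λ_k)`, returns `v`. The Hankel matrix of `θ` is `Vᵀ
D(t) V` with `V` Vandermonde and the moduli of the diagonal of `D` constant and nonzero. It is thus
invertible uniformly in time, which is the excitation needed for adaptation (`exists_steadyState`).

Since `η - θ` vanishes, the gradient law gives `ahat → a`, and moreover with a square-integrable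
error, recorded by an energy `E` with `E' ≤ -|ahat - a|²` (`parameter_convergence`). The regulator
matrix `A₀` at `a` may be singular, so no limit is claimed for `ζ`. Square integrability keeps `ζ`
bounded, and the residual `A₀ ζ - β` vanishes because `A₀ᵀ` is bounded below on the range of `A₀`
(`gradient_convergence`).

Vanishing residuals suffice: `x - X̂ v` obeys a Hurwitz equation with vanishing input, and `e` is a
combination, with bounded coefficients, of `x - X̂ v`, the reconstruction error of `v` and the
residual (`closedLoop_regulation`). Hurwitz stability is used through quadratic Lyapunov functions
built by induction on the eigenvalues (`exists_lyapunov_of_list`). -/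

namespace FeedforwardRegulation

/-! ### Global solutions of linear differential equations -/

section LinearODE

variable {ι κ : Type*} [Fintype ι] [Fintype κ]

theorem norm_mulVec_le {𝕜 : Type*} [NormedCommRing 𝕜] (A : Matrix ι κ 𝕜) (v : κ → 𝕜) :
    ‖A *ᵥ v‖ ≤ (∑ i, ∑ j, ‖A i j‖) * ‖v‖ := by
  have h0 : ∀ i, 0 ≤ ∑ j, ‖A i j‖ := fun i => Finset.sum_nonneg fun j _ => norm_nonneg _
  refine (pi_norm_le_iff_of_nonneg
    (mul_nonneg (Finset.sum_nonneg fun i _ => h0 i) (norm_nonneg _))).2 fun i => ?_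
  calc ‖(A *ᵥ v) i‖ ≤ ∑ j, ‖A i j * v j‖ := norm_sum_le _ _
    _ ≤ ∑ j, ‖A i j‖ * ‖v‖ := Finset.sum_le_sum fun j _ => (norm_mul_le _ _).trans
        (mul_le_mul_of_nonneg_left (norm_le_pi_norm v j) (norm_nonneg _))
    _ = (∑ j, ‖A i j‖) * ‖v‖ := by rw [Finset.sum_mul]
    _ ≤ _ := mul_le_mul_of_nonneg_right
        (Finset.single_le_sum (fun i _ => h0 i) (Finset.mem_univ i)) (norm_nonneg _)

/-- Coordinatewise truncation to `[-R, R]`. -/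
def clamp (R : ℝ) (x : ι → ℝ) : ι → ℝ := fun i => max (-R) (min R (x i))

theorem dist_clamp_le (R : ℝ) (x y : ι → ℝ) : ‖clamp R x - clamp R y‖ ≤ ‖x - y‖ := by
  refine (pi_norm_le_iff_of_nonneg (norm_nonneg _)).2 fun i => ?_
  refine le_trans ?_ (norm_le_pi_norm (x - y) i)
  simp only [clamp, Pi.sub_apply, Real.norm_eq_abs]
  rw [max_comm (-R), max_comm (-R), min_comm R, min_comm R]
  refine (abs_max_sub_max_le_abs _ _ _).trans ?_
  refine (abs_min_sub_min_le_max _ _ _ _).trans ?_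
  simp

theorem norm_clamp_le {R : ℝ} (hR : 0 ≤ R) (x : ι → ℝ) : ‖clamp R x‖ ≤ R := by
  refine (pi_norm_le_iff_of_nonneg hR).2 fun i => ?_
  simp only [clamp, Real.norm_eq_abs, abs_le]
  exact ⟨le_max_left _ _, max_le (by linarith) (min_le_left _ _)⟩

theorem norm_clamp_le_norm {R : ℝ} (hR : 0 ≤ R) (x : ι → ℝ) : ‖clamp R x‖ ≤ ‖x‖ := by
  have h := dist_clamp_le R x 0
  have h0 : clamp R (0 : ι → ℝ) = 0 := by
    funext i
    simp [clamp, hR]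
  simpa [h0] using h

theorem clamp_eq_self {R : ℝ} {x : ι → ℝ} (h : ‖x‖ ≤ R) : clamp R x = x := by
  funext i
  have := abs_le.1 ((norm_le_pi_norm x i).trans h)
  simp [clamp, this.1, this.2]

/-- Clamping the state makes the vector field bounded, so Picard–Lindelöf covers all of `[0, T]` at
once. The Gronwall estimate for the original equation also holds for the clamped one, so a clamp
placed at that bound is never active. -/
theorem exists_linearODE_Icc {A : ℝ → Matrix ι ι ℝ} {b : ℝ → ι → ℝ}
    (hA : ContinuousOn A (Ici 0)) (hb : ContinuousOn b (Ici 0)) (x₀ : ι → ℝ) {T : ℝ}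
    (hT : 0 ≤ T) :
    ∃ x : ℝ → ι → ℝ, x 0 = x₀ ∧
      ∀ t ∈ Icc 0 T, HasDerivWithinAt x (A t *ᵥ x t + b t) (Icc 0 T) t := by
  have hsub : Icc 0 T ⊆ Ici (0 : ℝ) := Icc_subset_Ici_self
  have hA' : ∀ i j, ContinuousOn (fun t => A t i j) (Icc 0 T) := fun i j =>
    (continuousOn_pi.1 (continuousOn_pi.1 (hA.mono hsub) i) j)
  obtain ⟨K, hK⟩ := (isCompact_Icc (a := (0 : ℝ)) (b := T)).exists_bound_of_continuousOn
    (f := fun t => ∑ i, ∑ j, ‖A t i j‖)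
    (continuousOn_finsetSum _ fun i _ => continuousOn_finsetSum _ fun j _ => (hA' i j).norm)
  obtain ⟨β, hβ⟩ := (isCompact_Icc (a := (0 : ℝ)) (b := T)).exists_bound_of_continuousOn
    (hb.mono hsub)
  have hK0 : 0 ≤ K := (norm_nonneg _).trans (hK 0 ⟨le_rfl, hT⟩)
  have hβ0 : 0 ≤ β := (norm_nonneg _).trans (hβ 0 ⟨le_rfl, hT⟩)
  have hmul : ∀ t ∈ Icc 0 T, ∀ y : ι → ℝ, ‖A t *ᵥ y‖ ≤ K * ‖y‖ := fun t ht y =>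
    (norm_mulVec_le (A t) y).trans
      (mul_le_mul_of_nonneg_right ((le_abs_self _).trans (hK t ht)) (norm_nonneg _))
  set R := gronwallBound ‖x₀‖ K β T with hRdef
  have hmono := gronwallBound_mono (norm_nonneg x₀) hβ0 hK0
  have hR0 : 0 ≤ R := by
    have := hmono hT
    rw [gronwallBound_x0] at this
    exact (norm_nonneg _).trans this
  have hL0 : 0 ≤ K * R + β := by positivity
  -- The clamped field is bounded by `K * R + β` everywhere, so a ball of radius `(K * R + β) * T`
  -- traps the solution for the whole time interval.
  have hpl : IsPicardLindelof (fun t x => A t *ᵥ clamp R x + b t)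
      (⟨0, le_rfl, hT⟩ : Icc (0 : ℝ) T) x₀ (⟨(K * R + β) * T, by positivity⟩ : NNReal) 0
      ⟨K * R + β, hL0⟩ ⟨K, hK0⟩ := by
    refine ⟨fun t ht => LipschitzWith.lipschitzOnWith ?_, fun x _ => ?_, fun t ht x _ => ?_, ?_⟩
    · refine LipschitzWith.of_dist_le_mul fun x y => ?_
      rw [dist_eq_norm, dist_eq_norm, add_sub_add_right_eq_sub, ← Matrix.mulVec_sub]
      exact (hmul t ht _).trans (mul_le_mul_of_nonneg_left (dist_clamp_le R x y) hK0)
    · refine ContinuousOn.add (continuousOn_pi.2 fun i => ?_) (hb.mono hsub)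
      exact continuousOn_finsetSum _ fun j _ => (hA' i j).mul continuousOn_const
    · refine (norm_add_le _ _).trans (add_le_add ((hmul t ht _).trans ?_) (hβ t ht))
      exact mul_le_mul_of_nonneg_left (norm_clamp_le hR0 x) hK0
    · simp only [sub_zero, sub_self, max_eq_left hT]
      exact (le_refl ((K * R + β) * T)).trans_eq (sub_zero _).symm
  obtain ⟨x, hx0, hx⟩ := hpl.exists_eq_forall_mem_Icc_hasDerivWithinAt₀
  have hx0 : x 0 = x₀ := hx0
  refine ⟨x, hx0, fun t ht => ?_⟩
  have hbound : ∀ s ∈ Icc 0 T, ‖x s‖ ≤ gronwallBound ‖x₀‖ K β (s - 0) := by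
    refine norm_le_gronwallBound_of_norm_deriv_right_le
      (fun s hs => (hx s hs).continuousWithinAt)
      (fun s hs => ((hx s (Ico_subset_Icc_self hs)).mono_of_mem_nhdsWithin ?_)) (by rw [hx0]) ?_
    · exact Icc_mem_nhdsGE_of_mem hs
    · intro s hs
      have hs' := Ico_subset_Icc_self hs
      refine (norm_add_le _ _).trans (add_le_add ((hmul s hs' _).trans ?_) (hβ s hs'))
      exact mul_le_mul_of_nonneg_left (norm_clamp_le_norm hR0 _) hK0
  have h1 : ‖x t‖ ≤ R := (hbound t ht).trans (by simpa using hmono ht.2)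
  have := hx t ht
  rwa [clamp_eq_self h1] at this

theorem linearODE_unique_Icc {A : ℝ → Matrix ι ι ℝ} {b : ℝ → ι → ℝ}
    (hA : ContinuousOn A (Ici 0)) {T : ℝ} {x y : ℝ → ι → ℝ}
    (hx : ∀ t ∈ Icc 0 T, HasDerivWithinAt x (A t *ᵥ x t + b t) (Icc 0 T) t)
    (hy : ∀ t ∈ Icc 0 T, HasDerivWithinAt y (A t *ᵥ y t + b t) (Icc 0 T) t)
    (h0 : x 0 = y 0) : EqOn x y (Icc 0 T) := by
  obtain ⟨K, hK⟩ := (isCompact_Icc (a := (0 : ℝ)) (b := T)).exists_bound_of_continuousOn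
    (f := fun t => ∑ i, ∑ j, ‖A t i j‖)
    (continuousOn_finsetSum _ fun i _ => continuousOn_finsetSum _ fun j _ =>
      (continuousOn_pi.1 (continuousOn_pi.1 (hA.mono Icc_subset_Ici_self) i) j).norm)
  refine ODE_solution_unique_of_mem_Icc_right (v := fun t x => A t *ᵥ x + b t)
    (s := fun _ => univ) (K := K.toNNReal) (fun t ht => LipschitzWith.lipschitzOnWith ?_)
    (fun t ht => (hx t ht).continuousWithinAt)
    (fun t ht => (hx t (Ico_subset_Icc_self ht)).mono_of_mem_nhdsWithin
      (Icc_mem_nhdsGE_of_mem ht)) (fun _ _ => trivial)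
    (fun t ht => (hy t ht).continuousWithinAt)
    (fun t ht => (hy t (Ico_subset_Icc_self ht)).mono_of_mem_nhdsWithin
      (Icc_mem_nhdsGE_of_mem ht)) (fun _ _ => trivial) h0
  refine LipschitzWith.of_dist_le_mul fun u w => ?_
  rw [dist_eq_norm, dist_eq_norm, add_sub_add_right_eq_sub, ← Matrix.mulVec_sub]
  refine (norm_mulVec_le (A t) _).trans (mul_le_mul_of_nonneg_right ?_ (norm_nonneg _))
  exact (le_abs_self _).trans ((hK t (Ico_subset_Icc_self ht)).trans (Real.le_coe_toNNReal K))

/-- A linear differential equation with continuous coefficients has a solution on `[0, ∞)`. -/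
theorem exists_linearODE {A : ℝ → Matrix ι ι ℝ} {b : ℝ → ι → ℝ}
    (hA : ContinuousOn A (Ici 0)) (hb : ContinuousOn b (Ici 0)) (x₀ : ι → ℝ) :
    ∃ x : ℝ → ι → ℝ, x 0 = x₀ ∧
      ∀ t ∈ Ici (0 : ℝ), HasDerivWithinAt x (A t *ᵥ x t + b t) (Ici 0) t := by
  choose y hy0 hy using fun N : ℕ => exists_linearODE_Icc hA hb x₀ (Nat.cast_nonneg (α := ℝ) N)
  have hmono : ∀ {N M : ℕ}, N ≤ M → EqOn (y N) (y M) (Icc 0 N) := fun {N M} h => by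
    have hc : (N : ℝ) ≤ M := Nat.cast_le.2 h
    refine linearODE_unique_Icc hA (hy N) (fun t ht => ?_) ((hy0 N).trans (hy0 M).symm)
    exact (hy M t (Icc_subset_Icc_right hc ht)).mono (Icc_subset_Icc_right hc)
  have hz : ∀ N : ℕ, ∀ t ∈ Icc (0 : ℝ) N, y ⌈t⌉₊ t = y N t := fun N t ht =>
    hmono (Nat.ceil_le.2 ht.2) ⟨ht.1, Nat.le_ceil t⟩
  -- By uniqueness the solutions on `[0, N]` extend each other. Near `t` the glued function equals a
  -- single `y N` with `N > t`.
  refine ⟨fun t => y ⌈t⌉₊ t, by simp [hy0], fun t ht => ?_⟩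
  have ht0 : (0 : ℝ) ≤ t := ht
  obtain ⟨N, hN⟩ := exists_nat_gt t
  have hmem : t ∈ Icc (0 : ℝ) N := ⟨ht0, hN.le⟩
  have h1 := (hy N t hmem).congr (fun s hs => hz N s hs) (hz N t hmem)
  simp only [← hz N t hmem] at h1
  refine h1.mono_of_mem_nhdsWithin ?_
  rw [← Ici_inter_Iic]
  exact inter_mem self_mem_nhdsWithin (mem_nhdsWithin_of_mem_nhds (Iic_mem_nhds hN))

end LinearODE

/-! ### Differential inequalities and quadratic Lyapunov functions -/

section Lyapunov

variable {ι κ : Type*} [Fintype ι] [Fintype κ]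

theorem antitoneOn_of_hasDerivWithinAt_nonpos {W W' : ℝ → ℝ} {T : ℝ} (hT : 0 ≤ T)
    (hW : ∀ t ∈ Ici (0 : ℝ), HasDerivWithinAt W (W' t) (Ici 0) t)
    (hle : ∀ t, T ≤ t → W' t ≤ 0) : AntitoneOn W (Ici T) := by
  have hd : ∀ t ∈ interior (Ici T), HasDerivAt W (W' t) t := fun t ht => by
    rw [interior_Ici] at ht
    have h0 : 0 < t := hT.trans_lt ht
    exact (hW t h0.le).hasDerivAt (Ici_mem_nhds h0)
  refine antitoneOn_of_deriv_nonpos (convex_Ici T)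
    (fun t ht => (hW t (hT.trans ht)).continuousWithinAt.mono (Ici_subset_Ici.2 hT))
    (fun t ht => (hd t ht).differentiableAt.differentiableWithinAt) fun t ht => ?_
  rw [(hd t ht).deriv]
  rw [interior_Ici] at ht
  exact hle t (le_of_lt ht)

/-- Once `ρ < α ε / 2`, the function `(W - ε / 2) exp (α t)` is nonincreasing, so `W` ends up below
`ε`. -/
theorem tendsto_zero_of_deriv_le {W W' ρ : ℝ → ℝ} {α : ℝ} (hα : 0 < α)
    (hW : ∀ t ∈ Ici (0 : ℝ), HasDerivWithinAt W (W' t) (Ici 0) t) (h0 : ∀ t, 0 ≤ W t)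
    (hle : ∀ᶠ t in atTop, W' t ≤ -α * W t + ρ t) (hρ : Tendsto ρ atTop (𝓝 0)) :
    Tendsto W atTop (𝓝 0) := by
  refine tendsto_order.2 ⟨fun b hb => Eventually.of_forall fun t => hb.trans_le (h0 t),
    fun ε hε => ?_⟩
  have hρ' := hρ.eventually (gt_mem_nhds (show 0 < α * (ε / 2) by positivity))
  obtain ⟨T, hT⟩ := eventually_atTop.1 (hle.and hρ')
  set S := max T 0 with hS
  have hanti : AntitoneOn (fun t => (W t - ε / 2) * Real.exp (α * t)) (Ici S) := by
    refine antitoneOn_of_hasDerivWithinAt_nonpos (le_max_right _ _)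
      (W' := fun t => W' t * Real.exp (α * t) +
        (W t - ε / 2) * (Real.exp (α * t) * (α * 1))) (fun t ht => ?_) fun t ht => ?_
    · exact ((hW t ht).sub_const _).mul
        (((hasDerivAt_id t).const_mul α).exp.hasDerivWithinAt)
    · obtain ⟨h1, h2⟩ := hT t ((le_max_left _ _).trans ht)
      have : W' t + (W t - ε / 2) * α ≤ 0 := by linarith
      have := mul_nonpos_of_nonpos_of_nonneg this (Real.exp_pos (α * t)).le
      linarith
  have hexp : Tendsto (fun t => (W S - ε / 2) * Real.exp (α * S) * Real.exp (-(α * t))) atTop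
      (𝓝 0) := by
    rw [← mul_zero ((W S - ε / 2) * Real.exp (α * S))]
    exact (Real.tendsto_exp_neg_atTop_nhds_zero.comp
      (tendsto_id.const_mul_atTop hα)).const_mul _
  filter_upwards [hexp.eventually (gt_mem_nhds (show 0 < ε / 2 by positivity)),
    eventually_ge_atTop S] with t ht htS
  have h1 := hanti (mem_Ici.2 le_rfl) htS htS
  have h2 := mul_le_mul_of_nonneg_right h1 (Real.exp_pos (-(α * t))).le
  simp only at h2
  rw [mul_assoc, ← Real.exp_add, add_neg_cancel, Real.exp_zero, mul_one] at h2
  linarith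

theorem dotProduct_self_nonneg (x : ι → ℝ) : 0 ≤ x ⬝ᵥ x :=
  Finset.sum_nonneg fun _ _ => mul_self_nonneg _

/-- The norm on `ι → ℝ` is the sup norm while energies use the dot product; this bound and the next
one translate between the two. -/
theorem norm_sq_le_dotProduct_self (x : ι → ℝ) : ‖x‖ ^ 2 ≤ x ⬝ᵥ x := by
  have h0 : 0 ≤ x ⬝ᵥ x := dotProduct_self_nonneg _
  rw [← Real.sqrt_le_sqrt_iff h0, Real.sqrt_sq (norm_nonneg _)]
  refine (pi_norm_le_iff_of_nonneg (Real.sqrt_nonneg _)).2 fun i => ?_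
  rw [Real.norm_eq_abs, ← Real.sqrt_mul_self_eq_abs]
  exact Real.sqrt_le_sqrt
    (Finset.single_le_sum (f := fun i => x i * x i) (fun i _ => mul_self_nonneg _)
      (Finset.mem_univ i))

theorem dotProduct_self_le_norm_sq (x : ι → ℝ) : x ⬝ᵥ x ≤ Fintype.card ι * ‖x‖ ^ 2 := by
  calc x ⬝ᵥ x ≤ ∑ _i : ι, ‖x‖ ^ 2 := Finset.sum_le_sum fun i _ => by
        have := norm_le_pi_norm x i
        rw [Real.norm_eq_abs] at this
        rw [← abs_mul_abs_self, sq]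
        exact mul_self_le_mul_self (abs_nonneg _) this
    _ = _ := by simp

theorem two_mul_dotProduct_le {ε : ℝ} (hε : 0 < ε) (x y : ι → ℝ) :
    2 * (x ⬝ᵥ y) ≤ ε * (x ⬝ᵥ x) + ε⁻¹ * (y ⬝ᵥ y) := by
  simp only [dotProduct, Finset.mul_sum, ← Finset.sum_add_distrib]
  refine Finset.sum_le_sum fun i _ => ?_
  have h : 0 ≤ ε⁻¹ * (ε * x i - y i) ^ 2 := by positivity
  have : ε⁻¹ * (ε * x i - y i) ^ 2 = ε * (x i * x i) + ε⁻¹ * (y i * y i) - 2 * (x i * y i) := by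
    field_simp
    ring
  linarith

theorem exists_dotProduct_mulVec_self_le (P : Matrix ι κ ℝ) :
    ∃ C > 0, ∀ x, (P *ᵥ x) ⬝ᵥ (P *ᵥ x) ≤ C * (x ⬝ᵥ x) := by
  set K := ∑ i, ∑ j, ‖P i j‖
  refine ⟨Fintype.card ι * K ^ 2 + 1, by positivity, fun x => ?_⟩
  have hx : 0 ≤ x ⬝ᵥ x := dotProduct_self_nonneg _
  calc (P *ᵥ x) ⬝ᵥ (P *ᵥ x) ≤ Fintype.card ι * ‖P *ᵥ x‖ ^ 2 := dotProduct_self_le_norm_sq _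
    _ ≤ Fintype.card ι * (K * ‖x‖) ^ 2 := by gcongr; exact norm_mulVec_le P x
    _ = Fintype.card ι * K ^ 2 * ‖x‖ ^ 2 := by ring
    _ ≤ Fintype.card ι * K ^ 2 * (x ⬝ᵥ x) := by gcongr; exact norm_sq_le_dotProduct_self x
    _ ≤ _ := by linarith

theorem exists_two_mul_dotProduct_mulVec_le (P : Matrix ι κ ℝ) {ε : ℝ} (hε : 0 < ε) :
    ∃ C > 0, ∀ x y, 2 * (x ⬝ᵥ P *ᵥ y) ≤ ε * (x ⬝ᵥ x) + C * (y ⬝ᵥ y) := by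
  obtain ⟨C, hC, h⟩ := exists_dotProduct_mulVec_self_le P
  refine ⟨ε⁻¹ * C, by positivity, fun x y => (two_mul_dotProduct_le hε x _).trans ?_⟩
  have := mul_le_mul_of_nonneg_left (h y) (inv_pos.2 hε).le
  linarith

theorem hasDerivWithinAt_mulVec {ι κ : Type*} [Fintype κ] [Finite ι] {x : ℝ → κ → ℝ} {x' : κ → ℝ} {s : Set ℝ} {t : ℝ}
    (P : Matrix ι κ ℝ) (hx : HasDerivWithinAt x x' s t) :
    HasDerivWithinAt (fun t => P *ᵥ x t) (P *ᵥ x') s t := by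
  refine hasDerivWithinAt_pi.2 fun i => ?_
  exact HasDerivWithinAt.fun_sum fun j _ => (hasDerivWithinAt_pi.1 hx j).const_mul (P i j)

theorem hasDerivWithinAt_dotProduct {x y : ℝ → ι → ℝ} {x' y' : ι → ℝ} {s : Set ℝ} {t : ℝ}
    (hx : HasDerivWithinAt x x' s t) (hy : HasDerivWithinAt y y' s t) :
    HasDerivWithinAt (fun t => x t ⬝ᵥ y t) (x' ⬝ᵥ y t + x t ⬝ᵥ y') s t := by
  simp only [dotProduct, ← Finset.sum_add_distrib]
  exact HasDerivWithinAt.fun_sum fun j _ =>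
    (hasDerivWithinAt_pi.1 hx j).mul (hasDerivWithinAt_pi.1 hy j)

theorem hasDerivWithinAt_quadratic {P : Matrix ι ι ℝ} (hP : P.IsSymm) {x : ℝ → ι → ℝ}
    {x' : ι → ℝ} {s : Set ℝ} {t : ℝ} (hx : HasDerivWithinAt x x' s t) :
    HasDerivWithinAt (fun t => x t ⬝ᵥ P *ᵥ x t) (2 * (x t ⬝ᵥ P *ᵥ x')) s t := by
  convert hasDerivWithinAt_dotProduct hx (hasDerivWithinAt_mulVec P hx) using 1
  rw [two_mul, dotProduct_mulVec x', ← mulVec_transpose, hP.eq, dotProduct_comm (P *ᵥ x')]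

theorem hasDerivWithinAt_dotProduct_self {x : ℝ → ι → ℝ}
    {x' : ι → ℝ} {s : Set ℝ} {t : ℝ} (hx : HasDerivWithinAt x x' s t) :
    HasDerivWithinAt (fun t => x t ⬝ᵥ x t) (2 * (x t ⬝ᵥ x')) s t := by
  convert hasDerivWithinAt_dotProduct hx hx using 1
  rw [two_mul, dotProduct_comm x']

theorem ofReal_mulVec {ι κ : Type*} [Fintype κ] (M : Matrix ι κ ℝ) (x : κ → ℝ) :
    (fun i => (((M *ᵥ x) i : ℝ) : ℂ)) =
      (M.map (algebraMap ℝ ℂ)) *ᵥ (fun i => (x i : ℂ)) := by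
  funext i
  simp [mulVec, dotProduct]

/-- The Gram matrix of the real quadratic form `x ↦ ∑ |(Z x)ᵢ|²`. -/
def gramReal (Z : Matrix ι ι ℂ) : Matrix ι ι ℝ :=
  (Z.map Complex.re)ᵀ * Z.map Complex.re + (Z.map Complex.im)ᵀ * Z.map Complex.im

theorem gramReal_isSymm (Z : Matrix ι ι ℂ) : (gramReal Z).IsSymm := by
  simp [gramReal, Matrix.IsSymm, transpose_add, transpose_mul]

theorem dotProduct_gramReal_mulVec (Z : Matrix ι ι ℂ) (x y : ι → ℝ) :
    x ⬝ᵥ gramReal Z *ᵥ y = ∑ i, ((starRingEnd ℂ ((Z *ᵥ fun j => (x j : ℂ)) i)) *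
      (Z *ᵥ fun j => (y j : ℂ)) i).re := by
  have hre : ∀ (x : ι → ℝ) i, ((Z *ᵥ fun j => (x j : ℂ)) i).re = (Z.map Complex.re *ᵥ x) i :=
    fun x i => by simp [mulVec, dotProduct]
  have him : ∀ (x : ι → ℝ) i, ((Z *ᵥ fun j => (x j : ℂ)) i).im = (Z.map Complex.im *ᵥ x) i :=
    fun x i => by simp [mulVec, dotProduct]
  simp only [Complex.mul_re, Complex.conj_re, Complex.conj_im, hre, him, neg_mul, sub_neg_eq_add,
    Finset.sum_add_distrib]
  rw [gramReal, add_mulVec, dotProduct_add, ← mulVec_mulVec, ← mulVec_mulVec, dotProduct_mulVec,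
    dotProduct_mulVec x (Z.map Complex.im)ᵀ, vecMul_transpose, vecMul_transpose]
  rfl

theorem re_conj_mul_le {μ z w : ℂ} (hμ : μ.re < 0) :
    2 * (starRingEnd ℂ z * (μ * z + w)).re ≤
      μ.re * Complex.normSq z + (-μ.re)⁻¹ * Complex.normSq w := by
  set α := -μ.re with hα
  have hα0 : 0 < α := by linarith
  have hμα : μ.re = -α := by simp [hα]
  have h : 0 ≤ α⁻¹ * ((α * z.re - w.re) ^ 2 + (α * z.im - w.im) ^ 2) := by positivity
  have h2 : α⁻¹ * ((α * z.re - w.re) ^ 2 + (α * z.im - w.im) ^ 2) =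
      α * Complex.normSq z + α⁻¹ * Complex.normSq w - 2 * (z.re * w.re + z.im * w.im) := by
    rw [Complex.normSq_apply, Complex.normSq_apply]
    field_simp
    ring
  have h3 : 2 * (starRingEnd ℂ z * (μ * z + w)).re =
      -2 * α * Complex.normSq z + 2 * (z.re * w.re + z.im * w.im) := by
    simp only [Complex.mul_re, Complex.mul_im, Complex.add_re, Complex.add_im, Complex.conj_re,
      Complex.conj_im, Complex.normSq_apply, hμα]
    ring
  rw [h3, hμα]
  linarith

variable [DecidableEq ι]

/-- Induction on the list. Let `Z` be the product over the tail and `z = Z x`. Along `x' = M x` one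
has `z' = μ z + (A - μ) z`, so `|z|²` decays at rate `-μ.re` up to the residual of the longer
product. Adding a multiple of `|Z x|²` to the form thus trades the old residual for the new one. For
a full list of eigenvalues the final residual is zero by Cayley–Hamilton. -/
theorem exists_lyapunov_of_list (M : Matrix ι ι ℝ) (l : List ℂ) (hl : ∀ μ ∈ l, μ.re < 0) :
    ∃ P : Matrix ι ι ℝ, P.IsSymm ∧ (∀ x, x ⬝ᵥ x ≤ x ⬝ᵥ P *ᵥ x) ∧ ∃ K > 0, ∀ x,
      2 * (x ⬝ᵥ P *ᵥ (M *ᵥ x)) ≤ -(x ⬝ᵥ x) + K * ∑ i, Complex.normSq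
        (((l.map fun μ => M.map (algebraMap ℝ ℂ) - algebraMap ℂ (Matrix ι ι ℂ) μ).prod *ᵥ
          fun j => (x j : ℂ)) i) := by
  induction l with
  | nil =>
    obtain ⟨C, hC, h⟩ := exists_two_mul_dotProduct_mulVec_le M one_pos
    refine ⟨1, isSymm_one, fun x => by simp, C + 2, by positivity, fun x => ?_⟩
    have := h x x
    simp only [List.map_nil, List.prod_nil, one_mulVec, Complex.normSq_ofReal]
    have e : ∑ i, x i * x i = x ⬝ᵥ x := rfl
    rw [e]
    linarith
  | cons μ l ih =>
    obtain ⟨P, hP, hPx, K, hK, h⟩ := ih fun ν hν => hl ν (List.mem_cons_of_mem _ hν)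
    have hμ : μ.re < 0 := hl μ List.mem_cons_self
    have hα : 0 < -μ.re := by linarith
    set A := M.map (algebraMap ℝ ℂ) with hA
    set Z := (l.map fun μ => A - algebraMap ℂ (Matrix ι ι ℂ) μ).prod with hZ
    have hcomm : Commute A Z := by
      refine Commute.list_prod_right _ _ fun B hB => ?_
      obtain ⟨ν, -, rfl⟩ := List.mem_map.1 hB
      exact (Commute.refl A).sub_right (Algebra.commutes ν A).symm
    -- This weight makes the decay `w * μ.re * |z|²` cancel the inherited term `K * |z|²` exactly.
    set w := K / (-μ.re) with hw
    have hw0 : 0 < w := div_pos hK hα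
    refine ⟨P + w • gramReal Z, hP.add ((gramReal_isSymm Z).smul w), fun x => ?_,
      w * (-μ.re)⁻¹, by positivity, fun x => ?_⟩
    · rw [add_mulVec, dotProduct_add, smul_mulVec, dotProduct_smul, dotProduct_gramReal_mulVec]
      have : 0 ≤ w • ∑ i, ((starRingEnd ℂ ((Z *ᵥ fun j => (x j : ℂ)) i)) *
          (Z *ᵥ fun j => (x j : ℂ)) i).re := by
        refine smul_nonneg hw0.le (Finset.sum_nonneg fun i _ => ?_)
        rw [← Complex.normSq_eq_conj_mul_self, Complex.ofReal_re]
        exact Complex.normSq_nonneg _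
      linarith [hPx x]
    · rw [add_mulVec, dotProduct_add, smul_mulVec, dotProduct_smul, dotProduct_gramReal_mulVec,
        ofReal_mulVec, List.map_cons, List.prod_cons, ← hA, ← hZ, smul_eq_mul]
      set z := Z *ᵥ fun j => (x j : ℂ) with hz
      have h1 : Z *ᵥ (A *ᵥ fun j => (x j : ℂ)) = A *ᵥ z := by
        rw [mulVec_mulVec, ← hcomm.eq, hz, mulVec_mulVec]
      have h2 : ((A - algebraMap ℂ (Matrix ι ι ℂ) μ) * Z) *ᵥ (fun j => (x j : ℂ)) =
          A *ᵥ z - μ • z := by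
        rw [← mulVec_mulVec, ← hz, sub_mulVec, Algebra.algebraMap_eq_smul_one, smul_mulVec,
          one_mulVec]
      rw [h1, h2]
      have h3 : 2 * ∑ i, (starRingEnd ℂ (z i) * (A *ᵥ z) i).re ≤
          μ.re * ∑ i, Complex.normSq (z i) +
            (-μ.re)⁻¹ * ∑ i, Complex.normSq ((A *ᵥ z - μ • z) i) := by
        rw [Finset.mul_sum, Finset.mul_sum, Finset.mul_sum, ← Finset.sum_add_distrib]
        refine Finset.sum_le_sum fun i _ => ?_
        have := re_conj_mul_le (z := z i) (w := (A *ᵥ z - μ • z) i) hμ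
        simpa using this
      have h4 := mul_le_mul_of_nonneg_left h3 hw0.le
      have h5 := h x
      have h6 : w * (μ.re * ∑ i, Complex.normSq (z i)) = -(K * ∑ i, Complex.normSq (z i)) := by
        have := hμ.ne
        rw [hw, div_neg, neg_mul, neg_inj]
        field_simp
      rw [mul_add, h6] at h4
      linarith

end Lyapunov

/-! ### Stability of Hurwitz systems under vanishing inputs -/

section Hurwitz

variable {ι : Type} [Fintype ι] [DecidableEq ι]

theorem IsHurwitz.exists_lyapunov {M : Matrix ι ι ℝ} (hM : IsHurwitz M) :
    ∃ P : Matrix ι ι ℝ, P.IsSymm ∧ (∀ x, x ⬝ᵥ x ≤ x ⬝ᵥ P *ᵥ x) ∧ ∃ C > 0,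
      (∀ x, x ⬝ᵥ P *ᵥ x ≤ C * (x ⬝ᵥ x)) ∧
      ∀ x r, 2 * (x ⬝ᵥ P *ᵥ (M *ᵥ x + r)) ≤ -(1 / 2) * (x ⬝ᵥ x) + C * (r ⬝ᵥ r) := by
  set A := M.map (algebraMap ℝ ℂ) with hA
  have hroots : ∀ μ ∈ A.charpoly.roots.toList, μ.re < 0 := fun μ hμ => by
    rw [Multiset.mem_toList] at hμ
    exact hM μ (mem_spectrum_iff_isRoot_charpoly.2 (Polynomial.isRoot_of_mem_roots hμ))
  obtain ⟨P, hP, hPx, K, -, hK⟩ := exists_lyapunov_of_list M _ hroots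
  -- Cayley–Hamilton, with the characteristic polynomial split over `ℂ`.
  have hprod : (A.charpoly.roots.toList.map
      fun μ => A - algebraMap ℂ (Matrix ι ι ℂ) μ).prod = 0 := by
    have h1 := Matrix.aeval_self_charpoly A
    rw [(IsAlgClosed.splits A.charpoly).eq_prod_roots_of_monic (charpoly_monic A),
      ← Multiset.coe_toList A.charpoly.roots, Multiset.map_coe, Multiset.prod_coe,
      map_list_prod, List.map_map] at h1
    rw [← h1]
    congr 1
    refine List.map_congr_left fun μ _ => ?_
    simp
  obtain ⟨C₁, hC₁, h₁⟩ := exists_two_mul_dotProduct_mulVec_le P one_pos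
  -- Half of the decay `-(x ⬝ᵥ x)` is spent on the cross term with the input `r`.
  obtain ⟨C₂, hC₂, h₂⟩ := exists_two_mul_dotProduct_mulVec_le P (ε := 1 / 2) (by norm_num)
  refine ⟨P, hP, hPx, C₁ + C₂ + 1, by positivity, fun x => ?_, fun x r => ?_⟩
  · have hx : 0 ≤ x ⬝ᵥ x := dotProduct_self_nonneg _
    have := h₁ x x
    have := mul_nonneg hC₂.le hx
    have := mul_nonneg hC₁.le hx
    nlinarith
  · have hr : 0 ≤ r ⬝ᵥ r := dotProduct_self_nonneg _
    have h3 := hK x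
    rw [← hA, hprod] at h3
    simp only [zero_mulVec, Pi.zero_apply, map_zero, Finset.sum_const_zero, mul_zero,
      add_zero] at h3
    rw [mulVec_add, dotProduct_add]
    have := h₂ x r
    have := mul_nonneg hC₁.le hr
    nlinarith

theorem tendsto_zero_iff_dotProduct_self {α ι : Type*} [Fintype ι] {l : Filter α}
    {x : α → ι → ℝ} :
    Tendsto x l (𝓝 0) ↔ Tendsto (fun t => x t ⬝ᵥ x t) l (𝓝 0) := by
  constructor
  · intro h
    have h' := (h.norm.pow 2).const_mul (Fintype.card ι : ℝ)
    simp only [norm_zero, ne_eq, OfNat.ofNat_ne_zero, not_false_eq_true, zero_pow, mul_zero] at h'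
    exact squeeze_zero (fun t => dotProduct_self_nonneg _)
      (fun t => dotProduct_self_le_norm_sq _) h'
  · intro h
    have h' := h.sqrt
    rw [Real.sqrt_zero] at h'
    refine squeeze_zero_norm (fun t => ?_) h'
    rw [← Real.sqrt_sq (norm_nonneg (x t))]
    exact Real.sqrt_le_sqrt (norm_sq_le_dotProduct_self _)

/-- A Hurwitz linear system driven by a vanishing input has vanishing solutions. -/
theorem IsHurwitz.tendsto_zero {M : Matrix ι ι ℝ} (hM : IsHurwitz M) {x r : ℝ → ι → ℝ}
    (hx : ∀ t ∈ Ici (0 : ℝ), HasDerivWithinAt x (M *ᵥ x t + r t) (Ici 0) t)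
    (hr : Tendsto r atTop (𝓝 0)) : Tendsto x atTop (𝓝 0) := by
  obtain ⟨P, hP, hPx, C, hC, hPC, hPM⟩ := hM.exists_lyapunov
  have h0 : ∀ t, 0 ≤ x t ⬝ᵥ x t := fun t => dotProduct_self_nonneg _
  have hW : Tendsto (fun t => x t ⬝ᵥ P *ᵥ x t) atTop (𝓝 0) := by
    refine tendsto_zero_of_deriv_le (α := 1 / (2 * C)) (by positivity)
      (ρ := fun t => C * (r t ⬝ᵥ r t))
      (fun t ht => hasDerivWithinAt_quadratic hP (hx t ht)) (fun t => (h0 t).trans (hPx _))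
      (Eventually.of_forall fun t => ?_) ?_
    · refine (hPM (x t) (r t)).trans ?_
      have h1 : 1 / (2 * C) * (x t ⬝ᵥ P *ᵥ x t) ≤ 1 / (2 * C) * (C * (x t ⬝ᵥ x t)) :=
        mul_le_mul_of_nonneg_left (hPC _) (by positivity)
      have h2 : 1 / (2 * C) * (C * (x t ⬝ᵥ x t)) = 1 / 2 * (x t ⬝ᵥ x t) := by
        field_simp
      linarith
    · simpa using (tendsto_zero_iff_dotProduct_self.1 hr).const_mul C
  exact tendsto_zero_iff_dotProduct_self.2 (squeeze_zero h0 (fun t => hPx _) hW)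

end Hurwitz

/-! ### Sums of complex exponentials -/

section Modes

/-- The value at `z` of the monic polynomial with lower coefficients `b`. -/
noncomputable def monicEval {N : ℕ} (b : Fin N → ℝ) (z : ℂ) : ℂ :=
  z ^ N + ∑ j, (b j : ℂ) * z ^ j.val

/-- The `i`-th derivative of the real part of `∑ g_k exp (λ_k t)`. -/
noncomputable def modal {n : ℕ} (lam g : Fin n → ℂ) (i : ℕ) (t : ℝ) : ℝ :=
  (∑ k, g k * lam k ^ i * Complex.exp (lam k * t)).re

variable {n : ℕ} {lam g : Fin n → ℂ}

theorem hasDerivAt_sum_exp (lam g : Fin n → ℂ) (i : ℕ) (t : ℝ) :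
    HasDerivAt (fun t : ℝ => ∑ k, g k * lam k ^ i * Complex.exp (lam k * t))
      (∑ k, g k * lam k ^ (i + 1) * Complex.exp (lam k * t)) t := by
  refine HasDerivAt.fun_sum fun k _ => ?_
  have h1 : HasDerivAt (fun t : ℝ => lam k * (t : ℂ)) (lam k * 1) t :=
    (Complex.ofRealCLM.hasDerivAt (x := t)).const_mul (lam k)
  exact (h1.cexp.const_mul (g k * lam k ^ i)).congr_deriv (by ring)

theorem hasDerivAt_modal (lam g : Fin n → ℂ) (i : ℕ) (t : ℝ) :
    HasDerivAt (modal lam g i) (modal lam g (i + 1) t) t :=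
  Complex.reCLM.hasFDerivAt.comp_hasDerivAt t (hasDerivAt_sum_exp lam g i t)

theorem norm_exp_of_re_eq_zero {z : ℂ} (hz : z.re = 0) (t : ℝ) :
    ‖Complex.exp (z * t)‖ = 1 := by
  simp [Complex.norm_exp, hz]

theorem abs_modal_le (hlam : ∀ k, (lam k).re = 0) (i : ℕ) (t : ℝ) :
    |modal lam g i t| ≤ ∑ k, ‖g k * lam k ^ i‖ := by
  refine (Complex.abs_re_le_norm _).trans ((norm_sum_le _ _).trans_eq ?_)
  refine Finset.sum_congr rfl fun k _ => ?_
  rw [norm_mul, norm_exp_of_re_eq_zero (hlam k), mul_one]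

/-- Conjugation only permutes the summands, so the sum is already real and taking the real part
loses nothing. -/
theorem ofReal_modal {τ : Equiv.Perm (Fin n)}
    (hlam : ∀ k, lam (τ k) = starRingEnd ℂ (lam k)) (hg : ∀ k, g (τ k) = starRingEnd ℂ (g k))
    (i : ℕ) (t : ℝ) :
    (modal lam g i t : ℂ) = ∑ k, g k * lam k ^ i * Complex.exp (lam k * t) := by
  refine Complex.conj_eq_iff_re.1 ?_
  rw [map_sum, ← Equiv.sum_comp τ]
  refine Finset.sum_congr rfl fun k _ => ?_
  rw [hlam, hg, map_mul, map_mul, map_pow, ← Complex.exp_conj, map_mul, Complex.conj_ofReal,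
    Complex.conj_conj, Complex.conj_conj]

/-- The differential operator `b(d/dt)` multiplies the amplitude of the `k`-th mode by `b(λ_k)`. -/
theorem modal_add_sum (lam g : Fin n → ℂ) {N : ℕ} (b : Fin N → ℝ) (i : ℕ) (t : ℝ) :
    modal lam g (i + N) t + ∑ j, b j * modal lam g (i + j) t =
      modal lam (fun k => g k * monicEval b (lam k)) i t := by
  simp only [modal, monicEval, ← Complex.re_ofReal_mul, ← Complex.re_sum, ← Complex.add_re]
  congr 1
  simp only [Finset.mul_sum]
  rw [Finset.sum_comm, ← Finset.sum_add_distrib]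
  refine Finset.sum_congr rfl fun k _ => ?_
  rw [mul_add, add_mul, add_mul, Finset.mul_sum, Finset.sum_mul, Finset.sum_mul]
  congr 1
  · ring
  · refine Finset.sum_congr rfl fun j _ => ?_
    ring

/-- All derivatives at `0` vanish, which gives a Vandermonde system for the amplitudes. -/
theorem eq_zero_of_sum_exp_eq_zero (hlam : Function.Injective lam)
    (h : ∀ t ∈ Ici (0 : ℝ), ∑ k, g k * Complex.exp (lam k * t) = 0) : g = 0 := by
  have key : ∀ i : ℕ, ∀ t ∈ Ici (0 : ℝ),
      ∑ k, g k * lam k ^ i * Complex.exp (lam k * t) = 0 := by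
    intro i
    induction i with
    | zero => simpa using h
    | succ i ih =>
      intro t ht
      have h1 := (hasDerivAt_sum_exp lam g i t).hasDerivWithinAt (s := Ici 0)
      have h2 : HasDerivWithinAt (fun t : ℝ => ∑ k, g k * lam k ^ i * Complex.exp (lam k * t))
          0 (Ici 0) t := (hasDerivWithinAt_const t (Ici 0) (0 : ℂ)).congr ih (ih t ht)
      exact (uniqueDiffOn_Ici 0 t ht).eq_deriv _ h1 h2
  refine eq_zero_of_forall_pow_sum_mul_pow_eq_zero hlam fun i => ?_
  simpa using key i 0 (mem_Ici.2 le_rfl)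

theorem exists_modes_of_fintype {ι : Type*} [Fintype ι] (hι : Fintype.card ι = n)
    {lam c : ι → ℂ} {τ : Equiv.Perm ι} (hinj : Function.Injective lam) (hc : ∀ k, c k ≠ 0)
    (hre : ∀ k, (lam k).re = 0) (hlam : ∀ k, lam (τ k) = starRingEnd ℂ (lam k))
    (hcτ : ∀ k, c (τ k) = starRingEnd ℂ (c k)) :
    ∃ (lam' c' : Fin n → ℂ) (τ' : Equiv.Perm (Fin n)), Function.Injective lam' ∧
      (∀ k, c' k ≠ 0) ∧ (∀ k, (lam' k).re = 0) ∧ (∀ k, lam' (τ' k) = starRingEnd ℂ (lam' k)) ∧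
      (∀ k, c' (τ' k) = starRingEnd ℂ (c' k)) ∧
      ∀ t : ℝ, ∑ k, c' k * Complex.exp (lam' k * t) = ∑ k, c k * Complex.exp (lam k * t) := by
  let e := Fintype.equivFinOfCardEq hι
  refine ⟨lam ∘ e.symm, c ∘ e.symm, (e.symm.trans τ).trans e, hinj.comp e.symm.injective,
    fun k => hc _, fun k => hre _, fun k => ?_, fun k => ?_, fun t => ?_⟩
  · simp [hlam]
  · simp [hcτ]
  · exact Equiv.sum_comp e.symm fun k => c k * Complex.exp (lam k * t)

theorem ofReal_mul_sin_eq (d ω φ t : ℝ) :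
    ((d * Real.sin (ω * t + φ) : ℝ) : ℂ) =
      -(d * Complex.I / 2 * Complex.exp (φ * Complex.I)) * Complex.exp (ω * Complex.I * t) +
        d * Complex.I / 2 * Complex.exp (-(φ * Complex.I)) *
          Complex.exp (-(ω * Complex.I) * t) := by
  push_cast
  rw [Complex.sin]
  have h1 : -((ω : ℂ) * t + φ) * Complex.I = -(φ * Complex.I) + -(ω * Complex.I) * t := by ring
  have h2 : ((ω : ℂ) * t + φ) * Complex.I = φ * Complex.I + ω * Complex.I * t := by ring
  rw [h1, h2, Complex.exp_add, Complex.exp_add]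
  ring

/-- Each sine contributes a conjugate pair of modes, and a nonzero constant contributes the
self-conjugate mode `λ = 0`. The parity rule for `n` makes the number of modes exactly `n`, which
later makes the Vandermonde matrix square. -/
theorem IsMultiTone.exists_modes {y : ℝ → Fin 1 → ℝ} (h : IsMultiTone n y) :
    ∃ (lam c : Fin n → ℂ) (τ : Equiv.Perm (Fin n)), Function.Injective lam ∧
      (∀ k, c k ≠ 0) ∧ (∀ k, (lam k).re = 0) ∧ (∀ k, lam (τ k) = starRingEnd ℂ (lam k)) ∧
      (∀ k, c (τ k) = starRingEnd ℂ (c k)) ∧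
      ∀ t ∈ Ici (0 : ℝ), (y t 0 : ℂ) = ∑ k, c k * Complex.exp (lam k * t) := by
  obtain ⟨q, d₀, d, ω, φ, hd, hω, hinj, hn, hy⟩ := h
  let lam₀ : Fin q ⊕ Fin q → ℂ :=
    Sum.elim (fun k => ω k * Complex.I) (fun k => -(ω k * Complex.I))
  let c₀ : Fin q ⊕ Fin q → ℂ :=
    Sum.elim (fun k => -(d k * Complex.I / 2 * Complex.exp (φ k * Complex.I)))
      (fun k => d k * Complex.I / 2 * Complex.exp (-(φ k * Complex.I)))
  have hpos : ∀ k l, (ω k : ℂ) * Complex.I ≠ -(ω l * Complex.I) := fun k l h => by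
    have := congrArg Complex.im h
    simp at this
    linarith [hω k, hω l]
  have hinj₀ : Function.Injective lam₀ := by
    rintro (k | k) (l | l) h
    · have : ω k = ω l := by simpa [lam₀] using h
      rw [hinj this]
    · exact (hpos k l h).elim
    · exact (hpos l k h.symm).elim
    · have : ω k = ω l := by simpa [lam₀] using h
      rw [hinj this]
  have hc₀ : ∀ k, c₀ k ≠ 0 := by
    rintro (k | k) <;> simp [c₀, hd k, Complex.exp_ne_zero]
  have hre₀ : ∀ k, (lam₀ k).re = 0 := by
    rintro (k | k) <;> simp [lam₀]
  have hlam₀ : ∀ k, lam₀ (Equiv.sumComm _ _ k) = starRingEnd ℂ (lam₀ k) := by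
    rintro (k | k) <;> simp [lam₀]
  have hcτ₀ : ∀ k, c₀ (Equiv.sumComm _ _ k) = starRingEnd ℂ (c₀ k) := by
    have h2 : starRingEnd ℂ 2 = 2 := Complex.conj_ofNat 2
    rintro (k | k) <;> simp [c₀, ← Complex.exp_conj, h2] <;> ring
  have hsum₀ : ∀ t : ℝ, ((∑ k, d k * Real.sin (ω k * t + φ k) : ℝ) : ℂ) =
      ∑ k, c₀ k * Complex.exp (lam₀ k * t) := fun t => by
    rw [Fintype.sum_sum_type, ← Finset.sum_add_distrib, Complex.ofReal_sum]
    exact Finset.sum_congr rfl fun k _ => ofReal_mul_sin_eq _ _ _ _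
  rcases hn with ⟨hn, h0⟩ | ⟨hn, h0⟩
  · obtain ⟨lam, c, τ, h1, h2, h3, h4, h5, h6⟩ := exists_modes_of_fintype (n := n)
      (by simp [hn, two_mul]) hinj₀ hc₀ hre₀ hlam₀ hcτ₀
    refine ⟨lam, c, τ, h1, h2, h3, h4, h5, fun t ht => ?_⟩
    rw [h6, ← hsum₀, hy t ht, h0, zero_add]
  · have hne : ∀ k, lam₀ k ≠ 0 := by
      rintro (k | k) <;> simp [lam₀, (hω k).ne']
    obtain ⟨lam, c, τ, h1, h2, h3, h4, h5, h6⟩ := exists_modes_of_fintype (n := n)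
      (ι := (Fin q ⊕ Fin q) ⊕ Unit)
      (lam := Sum.elim lam₀ fun _ => 0) (c := Sum.elim c₀ fun _ => (d₀ : ℂ))
      (τ := (Equiv.sumComm _ _).sumCongr (Equiv.refl _))
      (by simp [hn, two_mul]) (by
        rintro (k | k) (l | l) h
        · rw [hinj₀ (show lam₀ k = lam₀ l from h)]
        · exact (hne k h).elim
        · exact (hne l h.symm).elim
        · rfl)
      (by
        rintro (k | k)
        · exact hc₀ k
        · simpa using h0)
      (by
        rintro (k | k)
        · exact hre₀ k
        · simp)
      (by
        rintro (k | k)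
        · exact hlam₀ k
        · simp)
      (by
        rintro (k | k)
        · exact hcτ₀ k
        · simp)
    refine ⟨lam, c, τ, h1, h2, h3, h4, h5, fun t ht => ?_⟩
    rw [h6, hy t ht, Fintype.sum_sum_type, Complex.ofReal_add, hsum₀]
    simp [add_comm]

end Modes

/-! ### Spectrum of companion matrices -/

section Companion

variable {k : ℕ}

theorem companion_mulVec_of_lt (c : Fin k → ℝ) (x : Fin k → ℝ) {i : ℕ} (hi : i + 1 < k) :
    (companion c *ᵥ x) ⟨i, by omega⟩ = x ⟨i + 1, hi⟩ := by
  rw [mulVec, dotProduct, Finset.sum_eq_single ⟨i + 1, hi⟩]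
  · simp [companion, hi.ne]
  · intro j _ hj
    have : j.val ≠ i + 1 := fun h => hj (Fin.ext h)
    simp [companion, hi.ne, this]
  · simp

theorem companion_mulVec_of_eq (c : Fin k → ℝ) (x : Fin k → ℝ) {i : Fin k}
    (hi : i.val + 1 = k) : (companion c *ᵥ x) i = -∑ j, c j * x j := by
  simp [mulVec, dotProduct, companion, hi]

theorem companion_map_mulVec_of_lt (c : Fin k → ℝ) (x : Fin k → ℂ) {i : ℕ} (hi : i + 1 < k) :
    ((companion c).map (algebraMap ℝ ℂ) *ᵥ x) ⟨i, by omega⟩ = x ⟨i + 1, hi⟩ := by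
  rw [mulVec, dotProduct, Finset.sum_eq_single ⟨i + 1, hi⟩]
  · simp [companion, hi.ne]
  · intro j _ hj
    have : j.val ≠ i + 1 := fun h => hj (Fin.ext h)
    simp [companion, hi.ne, this]
  · simp

theorem companion_map_mulVec_of_eq (c : Fin k → ℝ) (x : Fin k → ℂ) {i : Fin k}
    (hi : i.val + 1 = k) :
    ((companion c).map (algebraMap ℝ ℂ) *ᵥ x) i = -∑ j, (c j : ℂ) * x j := by
  simp [mulVec, dotProduct, companion, hi]

theorem companion_map_mulVec_pow {c : Fin k → ℝ} {z : ℂ} (h : monicEval c z = 0) :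
    (companion c).map (algebraMap ℝ ℂ) *ᵥ (fun i : Fin k => z ^ i.val) =
      z • fun i : Fin k => z ^ i.val := by
  funext i
  obtain hi | hi := (Nat.succ_le_of_lt i.2).lt_or_eq
  · rw [show i = ⟨i.val, by omega⟩ from rfl, companion_map_mulVec_of_lt c _ hi]
    simp [pow_succ']
  · rw [companion_map_mulVec_of_eq c _ hi, Pi.smul_apply, smul_eq_mul, ← pow_succ']
    have hi' : i.val + 1 = k := hi
    rw [hi', neg_eq_iff_add_eq_zero, add_comm]
    exact h

theorem mem_spectrum_iff_exists_mulVec {ι : Type*} [Fintype ι] [DecidableEq ι]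
    {A : Matrix ι ι ℂ} {z : ℂ} : z ∈ spectrum ℂ A ↔ ∃ w ≠ 0, A *ᵥ w = z • w := by
  rw [spectrum.mem_iff, Matrix.isUnit_iff_isUnit_det, isUnit_iff_ne_zero, not_not,
    ← Matrix.exists_mulVec_eq_zero_iff]
  refine exists_congr fun w => and_congr_right fun _ => ?_
  rw [sub_mulVec, Algebra.algebraMap_eq_smul_one, smul_mulVec, one_mulVec, sub_eq_zero, eq_comm]

/-- The superdiagonal rows force an eigenvector to be a multiple of `(1, z, z², …)`; the last row
then says that `z` is a root. -/
theorem mem_spectrum_companion_iff {c : Fin k → ℝ} {z : ℂ} :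
    z ∈ spectrum ℂ ((companion c).map (algebraMap ℝ ℂ)) ↔ monicEval c z = 0 := by
  rw [mem_spectrum_iff_exists_mulVec]
  constructor
  · rintro ⟨w, hw, h⟩
    obtain ⟨i₀, hi₀⟩ := Function.ne_iff.1 hw
    have hk : 0 < k := i₀.pos
    have hpow : ∀ (i : ℕ) (hi : i < k), w ⟨i, hi⟩ = z ^ i * w ⟨0, hk⟩ := by
      intro i
      induction i with
      | zero => simp
      | succ i ih =>
        intro hi
        have h1 := congrFun h ⟨i, by omega⟩
        rw [companion_map_mulVec_of_lt c w hi, Pi.smul_apply, ih (by omega)] at h1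
        rw [h1, smul_eq_mul, pow_succ']
        ring
    have hw0 : w ⟨0, hk⟩ ≠ 0 := fun h0 => hi₀ (by
      rw [show i₀ = ⟨i₀.val, i₀.2⟩ from rfl, hpow, h0, mul_zero, Pi.zero_apply])
    have h1 := congrFun h ⟨k - 1, by omega⟩
    rw [companion_map_mulVec_of_eq c w (by simp only; omega), Pi.smul_apply, hpow, smul_eq_mul,
      ← mul_assoc, ← pow_succ', show k - 1 + 1 = k by omega] at h1
    refine (mul_eq_zero.1 (?_ : monicEval c z * w ⟨0, hk⟩ = 0)).resolve_right hw0
    rw [monicEval, add_mul, ← h1, neg_add_eq_zero, Finset.sum_mul]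
    refine Finset.sum_congr rfl fun j _ => ?_
    rw [show w j = z ^ j.val * w ⟨0, hk⟩ from hpow j.val j.2, mul_assoc]
  · intro h
    refine ⟨fun i => z ^ i.val, fun h0 => ?_, companion_map_mulVec_pow h⟩
    rcases Nat.eq_zero_or_pos k with rfl | hk
    · simp [monicEval] at h
    · simpa using congrFun h0 ⟨0, hk⟩

/-- Binomial coefficients give the polynomial `(z + 1) ^ k`. -/
theorem exists_isHurwitz_companion (k : ℕ) : ∃ m : Fin k → ℝ, IsHurwitz (companion m) := by
  refine ⟨fun j => k.choose j, fun z hz => ?_⟩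
  rw [mem_spectrum_companion_iff] at hz
  have h : monicEval (fun j : Fin k => (k.choose j : ℝ)) z = (z + 1) ^ k := by
    rw [add_pow, Finset.sum_range_succ, add_comm, monicEval]
    simp only [one_pow, mul_one, Nat.choose_self, Nat.cast_one, Complex.ofReal_natCast]
    rw [← Fin.sum_univ_eq_sum_range (fun j => z ^ j * (k.choose j : ℂ)), add_comm]
    simp only [mul_comm, add_comm]
  rw [h] at hz
  have : z = -1 := eq_neg_of_add_eq_zero_left (eq_zero_of_pow_eq_zero hz)
  simp [this]

end Companion

/-! ### Steady state of the observer -/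

section SteadyState

variable {n : ℕ}

theorem gam_mulVec_apply (x : Fin n → ℝ) (hn : 0 < n) (i : Fin 1) :
    (Gam n *ᵥ x) i = x ⟨0, hn⟩ := by
  rw [mulVec, dotProduct, Finset.sum_eq_single ⟨0, hn⟩]
  · simp [Gam]
  · intro j _ hj
    have : j.val ≠ 0 := fun h => hj (Fin.ext h)
    simp [Gam, this]
  · simp

theorem gam_mulVec_eq_modal {lam c : Fin n → ℂ} {v : ℝ → Fin n → ℝ} {t : ℝ}
    (hy : ((Gam n *ᵥ v t) 0 : ℂ) = ∑ k, c k * Complex.exp (lam k * t)) :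
    (Gam n *ᵥ v t) 0 = modal lam c 0 t := by
  simp only [modal, pow_zero, mul_one]
  rw [← hy, Complex.ofReal_re]

/-- The superdiagonal of the companion matrix makes each component the derivative of the preceding
one, starting from the output. -/
theorem exosystem_eq_modal {a : Fin n → ℝ} {v : ℝ → Fin n → ℝ} {lam c : Fin n → ℂ}
    (hv : ∀ t ∈ Ici (0 : ℝ), HasDerivWithinAt v (companion a *ᵥ v t) (Ici 0) t)
    (hy : ∀ t ∈ Ici (0 : ℝ), ((Gam n *ᵥ v t) 0 : ℂ) = ∑ k, c k * Complex.exp (lam k * t))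
    {t : ℝ} (ht : t ∈ Ici (0 : ℝ)) (i : Fin n) : v t i = modal lam c i t := by
  have key : ∀ (i : ℕ) (hi : i < n), ∀ t ∈ Ici (0 : ℝ), v t ⟨i, hi⟩ = modal lam c i t := by
    intro i
    induction i with
    | zero =>
      intro hi t ht
      rw [← gam_mulVec_eq_modal (hy t ht), gam_mulVec_apply _ hi]
    | succ i ih =>
      intro hi t ht
      have h1 := hasDerivWithinAt_pi.1 (hv t ht) ⟨i, by omega⟩
      rw [companion_mulVec_of_lt a _ hi] at h1
      have h2 := (hasDerivAt_modal lam c i t).hasDerivWithinAt (s := Ici 0)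
      exact (uniqueDiffOn_Ici 0 t ht).eq_deriv _ h1
        (h2.congr (ih (by omega)) (ih (by omega) t ht))
  exact key i i.2 t ht

/-- The last companion row says `a(d/dt) y₀ = 0`. The amplitudes `c_k a(λ_k)` of this zero signal
vanish by independence of the exponentials, and `c_k ≠ 0`. -/
theorem monicEval_eq_zero_of_exosystem {a : Fin n → ℝ} {v : ℝ → Fin n → ℝ} {lam c : Fin n → ℂ}
    {τ : Equiv.Perm (Fin n)} (hinj : Function.Injective lam) (hc : ∀ k, c k ≠ 0)
    (hlam : ∀ k, lam (τ k) = starRingEnd ℂ (lam k))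
    (hcτ : ∀ k, c (τ k) = starRingEnd ℂ (c k))
    (hv : ∀ t ∈ Ici (0 : ℝ), HasDerivWithinAt v (companion a *ᵥ v t) (Ici 0) t)
    (hy : ∀ t ∈ Ici (0 : ℝ), ((Gam n *ᵥ v t) 0 : ℂ) = ∑ k, c k * Complex.exp (lam k * t))
    (k : Fin n) : monicEval a (lam k) = 0 := by
  have hmon : ∀ k, monicEval a (lam (τ k)) = starRingEnd ℂ (monicEval a (lam k)) := fun k => by
    simp [monicEval, hlam]
  have hzero : (fun k => c k * monicEval a (lam k)) = 0 := by
    refine eq_zero_of_sum_exp_eq_zero hinj fun t ht => ?_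
    have h0 : modal lam (fun k => c k * monicEval a (lam k)) 0 t = 0 := by
      have hn : 0 < n := k.pos
      rw [← modal_add_sum, zero_add]
      have h1 := hasDerivWithinAt_pi.1 (hv t ht) ⟨n - 1, by omega⟩
      rw [companion_mulVec_of_eq a _ (by simp only; omega)] at h1
      have h2 := (hasDerivAt_modal lam c (n - 1) t).hasDerivWithinAt (s := Ici 0)
      have h3 := (uniqueDiffOn_Ici 0 t ht).eq_deriv _ h1
        (h2.congr (fun s hs => exosystem_eq_modal hv hy hs ⟨n - 1, by omega⟩)
          (exosystem_eq_modal hv hy ht ⟨n - 1, by omega⟩))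
      rw [show n - 1 + 1 = n by omega] at h3
      rw [← h3, neg_add_eq_zero]
      refine Finset.sum_congr rfl fun j _ => ?_
      rw [exosystem_eq_modal hv hy ht j, zero_add]
    have h1 := ofReal_modal (g := fun k => c k * monicEval a (lam k)) hlam
      (fun k => by rw [hcτ, hmon, map_mul]) 0 t
    rw [h0] at h1
    simpa using h1.symm
  exact (mul_eq_zero.1 (congrFun hzero k)).resolve_left (hc k)

/-- `Ξ(a)` is the observer polynomial evaluated at `Φ(a)`, so it acts on an eigenvector of `Φ(a)` by
the value of that polynomial at the eigenvalue. -/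
theorem xi_map_mulVec_pow {m : Fin (2 * n) → ℝ} {a : Fin n → ℝ} {z : ℂ}
    (h : monicEval a z = 0) :
    (Xi m a).map (algebraMap ℝ ℂ) *ᵥ (fun i : Fin n => z ^ i.val) =
      monicEval m z • fun i : Fin n => z ^ i.val := by
  set A := (companion a).map (algebraMap ℝ ℂ) with hA
  have hpow : ∀ j : ℕ, A ^ j *ᵥ (fun i : Fin n => z ^ i.val) =
      z ^ j • fun i : Fin n => z ^ i.val := by
    intro j
    induction j with
    | zero => simp
    | succ j ih =>
      rw [pow_succ, ← mulVec_mulVec, companion_map_mulVec_pow h, mulVec_smul, ih, smul_smul,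
        pow_succ']
  have hXi : (Xi m a).map (algebraMap ℝ ℂ) =
      A ^ (2 * n) + ∑ j : Fin (2 * n), (m j : ℂ) • A ^ j.val := by
    have hsmul : ∀ (r : ℝ) (B : Matrix (Fin n) (Fin n) ℝ),
        (algebraMap ℝ ℂ).mapMatrix (r • B) = (r : ℂ) • (algebraMap ℝ ℂ).mapMatrix B := by
      intro r B
      ext i j
      simp
    rw [← RingHom.mapMatrix_apply, Xi, map_add, map_sum, map_pow]
    simp only [hsmul, map_pow]
    rfl
  rw [hXi, add_mulVec, sum_mulVec, hpow, monicEval, add_smul, Finset.sum_smul]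
  congr 1
  refine Finset.sum_congr rfl fun j _ => ?_
  rw [smul_mulVec, hpow, smul_smul]

/-- The Hankel matrix factors as `Vᵀ D(t) V` with `V` Vandermonde and `D(t)` diagonal with entries
`g_k exp (λ_k t)`. The exponentials have modulus one, so each factor is inverted with a bound
independent of `t`. -/
theorem exists_norm_le_hankel {lam g : Fin n → ℂ} (hinj : Function.Injective lam)
    (hg : ∀ k, g k ≠ 0) (hre : ∀ k, (lam k).re = 0) {θ : ℝ → Fin (2 * n) → ℝ}
    (hθ : ∀ t i, (θ t i : ℂ) = ∑ k, g k * lam k ^ i.val * Complex.exp (lam k * t)) :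
    ∃ C : ℝ, 0 < C ∧ ∀ t w, ‖w‖ ≤ C * ‖Hankel (θ t) *ᵥ w‖ := by
  set V : Matrix (Fin n) (Fin n) ℂ := vandermonde lam with hV
  have hdet : IsUnit V.det := isUnit_iff_ne_zero.2 (det_vandermonde_ne_zero_iff.2 hinj)
  have hdetT : IsUnit Vᵀ.det := by rwa [det_transpose]
  set K₁ := ∑ i, ∑ j, ‖V⁻¹ i j‖
  set K₂ := ∑ k, ‖(g k)⁻¹‖
  set K₃ := ∑ i, ∑ j, ‖(Vᵀ)⁻¹ i j‖
  have hK₁ : 0 ≤ K₁ := Finset.sum_nonneg fun i _ => Finset.sum_nonneg fun j _ => norm_nonneg _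
  have hK₂ : 0 ≤ K₂ := Finset.sum_nonneg fun i _ => norm_nonneg _
  have hK₃ : 0 ≤ K₃ := Finset.sum_nonneg fun i _ => Finset.sum_nonneg fun j _ => norm_nonneg _
  have hnorm : ∀ x : Fin n → ℝ, ‖fun i => (x i : ℂ)‖ = ‖x‖ := fun x => by
    simp [Pi.norm_def]
  -- The summand `1` keeps the constant positive when `n = 0`.
  refine ⟨K₁ * (K₂ * K₃) + 1, by positivity, fun t w => ?_⟩
  set wc : Fin n → ℂ := fun i => (w i : ℂ) with hwc
  set b := V *ᵥ wc with hb
  set d : Fin n → ℂ := fun k => g k * Complex.exp (lam k * t) * b k with hd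
  have h1 : ‖wc‖ ≤ K₁ * ‖b‖ := by
    have : wc = V⁻¹ *ᵥ b := by rw [hb, mulVec_mulVec, nonsing_inv_mul _ hdet, one_mulVec]
    exact (congrArg norm this).trans_le (norm_mulVec_le _ _)
  have h2 : ‖b‖ ≤ K₂ * ‖d‖ := by
    refine (pi_norm_le_iff_of_nonneg (by positivity)).2 fun k => ?_
    have hk : ‖b k‖ = ‖(g k)⁻¹‖ * ‖d k‖ := by
      rw [hd, norm_mul, norm_mul, norm_exp_of_re_eq_zero (hre k), mul_one, norm_inv, ← mul_assoc,
        inv_mul_cancel₀ (norm_ne_zero_iff.2 (hg k)), one_mul]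
    rw [hk]
    exact mul_le_mul (Finset.single_le_sum (f := fun k => ‖(g k)⁻¹‖)
      (fun i _ => norm_nonneg _) (Finset.mem_univ k)) (norm_le_pi_norm d k) (norm_nonneg _) hK₂
  have h3 : ‖d‖ ≤ K₃ * ‖Vᵀ *ᵥ d‖ := by
    have : d = (Vᵀ)⁻¹ *ᵥ (Vᵀ *ᵥ d) := by
      rw [mulVec_mulVec, nonsing_inv_mul _ hdetT, one_mulVec]
    exact (congrArg norm this).trans_le (norm_mulVec_le _ _)
  have h4 : (fun i => ((Hankel (θ t) *ᵥ w) i : ℂ)) = Vᵀ *ᵥ d := by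
    rw [ofReal_mulVec]
    funext i
    simp only [mulVec, dotProduct, hd, hb, hV, transpose_apply, vandermonde_apply, map_apply,
      Hankel, of_apply, Complex.coe_algebraMap, hθ, Finset.sum_mul, Finset.mul_sum, hwc]
    rw [Finset.sum_comm]
    refine Finset.sum_congr rfl fun k _ => Finset.sum_congr rfl fun j _ => ?_
    ring
  rw [← hnorm w, ← hnorm (Hankel (θ t) *ᵥ w), h4]
  calc ‖wc‖ ≤ K₁ * (K₂ * (K₃ * ‖Vᵀ *ᵥ d‖)) := h1.trans (mul_le_mul_of_nonneg_left
        (h2.trans (mul_le_mul_of_nonneg_left h3 hK₂)) hK₁)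
    _ ≤ _ := by linarith [norm_nonneg (Vᵀ *ᵥ d)]

/-- The steady state of the observer driven by a multi-tone exosystem output. -/
theorem exists_steadyState {a : Fin n → ℝ} {m : Fin (2 * n) → ℝ} {v : ℝ → Fin n → ℝ}
    (hm : IsHurwitz (companion m))
    (hv : ∀ t ∈ Ici (0 : ℝ), HasDerivWithinAt v (companion a *ᵥ v t) (Ici 0) t)
    (hy : IsMultiTone n fun t => Gam n *ᵥ v t) :
    ∃ (θ : ℝ → Fin (2 * n) → ℝ) (C : ℝ), 0 < C ∧
      (∀ t ∈ Ici (0 : ℝ),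
        HasDerivWithinAt θ (companion m *ᵥ θ t + Nvec n *ᵥ (Gam n *ᵥ v t)) (Ici 0) t) ∧
      (∀ t, Hankel (θ t) *ᵥ a + lower (θ t) = 0) ∧
      (∀ t ∈ Ici (0 : ℝ), Xi m a *ᵥ upper (θ t) = v t) ∧
      (∀ t w, ‖w‖ ≤ C * ‖Hankel (θ t) *ᵥ w‖) ∧
      (∀ t, ‖θ t‖ ≤ C) ∧ ∀ t ∈ Ici (0 : ℝ), ‖v t‖ ≤ C := by
  obtain ⟨lam, c, τ, hinj, hc, hre, hlam, hcτ, hy⟩ := hy.exists_modes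
  have ha := monicEval_eq_zero_of_exosystem hinj hc hlam hcτ hv hy
  have hp : ∀ k, monicEval m (lam k) ≠ 0 := fun k h =>
    (hm (lam k) (mem_spectrum_companion_iff.2 h)).ne (hre k)
  have hmon : ∀ k, monicEval m (lam (τ k)) = starRingEnd ℂ (monicEval m (lam k)) := fun k => by
    simp [monicEval, hlam]
  -- The particular solution of `m(d/dt) θ₁ = y₀`. The denominators are nonzero because the roots of
  -- `m` lie in the open left half-plane and the `λ_k` on the imaginary axis.
  set g : Fin n → ℂ := fun k => c k / monicEval m (lam k) with hg
  have hgp : (fun k => g k * monicEval m (lam k)) = c := by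
    funext k
    exact div_mul_cancel₀ _ (hp k)
  have hgτ : ∀ k, g (τ k) = starRingEnd ℂ (g k) := fun k => by
    simp only [hg, hcτ, hmon, map_div₀]
  set θ : ℝ → Fin (2 * n) → ℝ := fun t i => modal lam g i t with hθ
  have hθc : ∀ t i, (θ t i : ℂ) = ∑ k, g k * lam k ^ i.val * Complex.exp (lam k * t) :=
    fun t i => ofReal_modal hlam hgτ i t
  obtain ⟨C₁, hC₁, h₁⟩ := exists_norm_le_hankel hinj
    (fun k => div_ne_zero (hc k) (hp k)) hre hθc
  have hbound : ∀ (g : Fin n → ℂ) (N : ℕ), ∃ C, 0 ≤ C ∧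
      ∀ t, ∀ i : Fin N, |modal lam g i t| ≤ C := fun g N => by
    refine ⟨∑ i : Fin N, ∑ k, ‖g k * lam k ^ i.val‖,
      Finset.sum_nonneg fun i _ => Finset.sum_nonneg fun k _ => norm_nonneg _, fun t i => ?_⟩
    exact (abs_modal_le hre _ _).trans
      (Finset.single_le_sum (f := fun i : Fin N => ∑ k, ‖g k * lam k ^ i.val‖)
        (fun i _ => Finset.sum_nonneg fun k _ => norm_nonneg _) (Finset.mem_univ i))
  obtain ⟨C₂, hC₂, h₂⟩ := hbound g (2 * n)
  obtain ⟨C₃, hC₃, h₃⟩ := hbound c n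
  refine ⟨θ, C₁ + C₂ + C₃, by positivity, fun t ht => ?_, fun t => ?_, fun t ht => ?_,
    fun t w => ?_, fun t => ?_, fun t ht => ?_⟩
  · refine hasDerivWithinAt_pi.2 fun i => ?_
    refine (hasDerivAt_modal lam g i t).hasDerivWithinAt.congr_deriv ?_
    have hN : (Nvec n *ᵥ (Gam n *ᵥ v t)) i =
        if i.val + 1 = 2 * n then modal lam c 0 t else 0 := by
      rw [← gam_mulVec_eq_modal (hy t ht)]
      simp [Nvec, mulVec, dotProduct]
    rw [Pi.add_apply, hN]
    obtain hi | hi := (Nat.succ_le_of_lt i.2).lt_or_eq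
    · have h := companion_mulVec_of_lt m (θ t) hi
      rw [if_neg hi.ne, add_zero]
      exact h.symm
    · have hi' : i.val + 1 = 2 * n := hi
      rw [companion_mulVec_of_eq m _ hi', if_pos hi', ← hgp, ← modal_add_sum, hi']
      simp [hθ]
  · funext i
    have h := modal_add_sum lam g a i t
    have h0 : modal lam (fun k => g k * monicEval a (lam k)) i t = 0 := by
      simp [modal, ha]
    rw [h0] at h
    simp only [Pi.add_apply, mulVec, dotProduct, Hankel, of_apply, lower, hθ, Pi.zero_apply]
    rw [← h, add_comm, add_comm n i.val]
    congr 1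
    exact Finset.sum_congr rfl fun j _ => mul_comm _ _
  · have hinjc : Function.Injective fun (x : Fin n → ℝ) i => (x i : ℂ) := fun x y h => by
      funext i
      exact Complex.ofReal_injective (congrFun h i)
    apply hinjc
    have hup : (fun i => (upper (θ t) i : ℂ)) =
        ∑ k, (g k * Complex.exp (lam k * t)) • fun i : Fin n => lam k ^ i.val := by
      funext i
      rw [Finset.sum_apply]
      refine (hθc t ⟨i.val, by omega⟩).trans (Finset.sum_congr rfl fun k _ => ?_)
      simp only [Pi.smul_apply, smul_eq_mul]
      ring
    simp only
    rw [ofReal_mulVec, hup, mulVec_sum]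
    funext i
    rw [Finset.sum_apply, exosystem_eq_modal hv hy ht i, ofReal_modal hlam hcτ]
    refine Finset.sum_congr rfl fun k _ => ?_
    rw [mulVec_smul, xi_map_mulVec_pow (ha k), ← congrFun hgp k]
    simp only [Pi.smul_apply, smul_eq_mul]
    ring
  · exact (h₁ t w).trans (mul_le_mul_of_nonneg_right (by linarith) (norm_nonneg _))
  · refine (pi_norm_le_iff_of_nonneg (by positivity)).2 fun i => ?_
    exact (h₂ t i).trans (by linarith)
  · refine (pi_norm_le_iff_of_nonneg (by positivity)).2 fun i => ?_
    rw [exosystem_eq_modal hv hy ht i]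
    exact (h₃ t i).trans (by linarith)

end SteadyState

/-! ### Convergence of the two gradient laws -/

section Adaptation

variable {ι κ : Type*} [Fintype ι] [Fintype κ]

theorem tendsto_mulVec {α ι κ : Type*} [Fintype κ] {l : Filter α} {M : α → Matrix ι κ ℝ} {v : α → κ → ℝ}
    {M₀ : Matrix ι κ ℝ} {v₀ : κ → ℝ} (hM : Tendsto M l (𝓝 M₀)) (hv : Tendsto v l (𝓝 v₀)) :
    Tendsto (fun t => M t *ᵥ v t) l (𝓝 (M₀ *ᵥ v₀)) :=
  ((continuous_fst.matrix_mulVec continuous_snd).tendsto (M₀, v₀)).comp (hM.prodMk_nhds hv)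

theorem tendsto_mulVec_zero_of_bounded_vec {α : Type*} {l : Filter α} {M : α → Matrix ι κ ℝ}
    {v : α → κ → ℝ} {c : ℝ} (hM : Tendsto M l (𝓝 0)) (hv : ∀ᶠ t in l, ‖v t‖ ≤ c) :
    Tendsto (fun t => M t *ᵥ v t) l (𝓝 0) := by
  have hcont : Continuous fun M : Matrix ι κ ℝ => ∑ i, ∑ j, ‖M i j‖ :=
    continuous_finsetSum _ fun i _ => continuous_finsetSum _ fun j _ =>
      (continuous_id.matrix_elem i j).norm
  have h0 := ((hcont.tendsto 0).comp hM).mul_const c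
  simp only [Matrix.zero_apply, norm_zero, Finset.sum_const_zero, zero_mul] at h0
  refine squeeze_zero_norm' (hv.mono fun t ht => (norm_mulVec_le (M t) (v t)).trans ?_) h0
  exact mul_le_mul_of_nonneg_left ht
    (Finset.sum_nonneg fun i _ => Finset.sum_nonneg fun j _ => norm_nonneg _)

theorem norm_mulVec_le_of_entries {M : Matrix ι κ ℝ} {c : ℝ} (hM : ∀ i j, ‖M i j‖ ≤ c)
    (v : κ → ℝ) : ‖M *ᵥ v‖ ≤ Fintype.card ι * Fintype.card κ * c * ‖v‖ := by
  refine (norm_mulVec_le M v).trans (mul_le_mul_of_nonneg_right ?_ (norm_nonneg _))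
  calc ∑ i, ∑ j, ‖M i j‖ ≤ ∑ _i : ι, ∑ _j : κ, c :=
        Finset.sum_le_sum fun i _ => Finset.sum_le_sum fun j _ => hM i j
    _ = _ := by simp [mul_assoc]

theorem tendsto_mulVec_zero_of_bounded_matrix {α : Type*} {l : Filter α} {M : α → Matrix ι κ ℝ}
    {v : α → κ → ℝ} {c : ℝ} (hM : ∀ᶠ t in l, ∀ i j, ‖M t i j‖ ≤ c) (hv : Tendsto v l (𝓝 0)) :
    Tendsto (fun t => M t *ᵥ v t) l (𝓝 0) := by
  have h0 := hv.norm.const_mul (Fintype.card ι * Fintype.card κ * c)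
  rw [norm_zero, mul_zero] at h0
  exact squeeze_zero_norm' (hM.mono fun t ht => norm_mulVec_le_of_entries ht (v t)) h0

theorem exists_norm_le_of_eventually {E : Type*} [NormedAddCommGroup E] {f : ℝ → E}
    (hf : ContinuousOn f (Ici 0)) {c : ℝ} (h : ∀ᶠ t in atTop, ‖f t‖ ≤ c) :
    ∃ c, ∀ t ∈ Ici (0 : ℝ), ‖f t‖ ≤ c := by
  obtain ⟨T, hT⟩ := eventually_atTop.1 h
  obtain ⟨c', hc'⟩ := (isCompact_Icc (a := (0 : ℝ)) (b := T)).exists_bound_of_continuousOn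
    (hf.mono Icc_subset_Ici_self)
  refine ⟨max c c', fun t ht => ?_⟩
  rcases le_total T t with h | h
  · exact (hT t h).trans (le_max_left _ _)
  · exact (hc' t ⟨ht, h⟩).trans (le_max_right _ _)

/-- The difference of the two sides is `|z + δ|²`. -/
theorem neg_two_mul_dotProduct_add_le (z δ : ι → ℝ) :
    -2 * (z ⬝ᵥ (z + δ)) ≤ -(z ⬝ᵥ z) + δ ⬝ᵥ δ := by
  have h := dotProduct_self_nonneg (z + δ)
  simp only [add_dotProduct, dotProduct_add] at h ⊢
  rw [dotProduct_comm δ z] at h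
  linarith

theorem dotProduct_gradient (A : Matrix ι κ ℝ) (x : κ → ℝ) (y : ι → ℝ) (k : ℝ) :
    2 * (x ⬝ᵥ (-k • (Aᵀ *ᵥ y))) = k * (-2 * ((A *ᵥ x) ⬝ᵥ y)) := by
  rw [dotProduct_smul, dotProduct_mulVec, vecMul_transpose, smul_eq_mul]
  ring

/-- Since `Aᵀ A` and `A` have the same kernel, `A x` is a linear function of `Aᵀ A x`, bounded in
finite dimension. Thus `Aᵀ` is bounded below on the range of `A`, even for singular `A`. -/
theorem exists_dotProduct_self_le_gram [DecidableEq ι] [DecidableEq κ] (A : Matrix ι κ ℝ) :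
    ∃ c > 0, ∀ x, c * ((A *ᵥ x) ⬝ᵥ (A *ᵥ x)) ≤
      (Aᵀ *ᵥ (A *ᵥ x)) ⬝ᵥ (Aᵀ *ᵥ (A *ᵥ x)) := by
  set f := (Aᵀ * A).mulVecLin with hf
  obtain ⟨g, hg⟩ := LinearMap.exists_rightInverse_of_surjective f.rangeRestrict
    (LinearMap.range_rangeRestrict f)
  set L := LinearMap.toContinuousLinearMap (A.mulVecLin ∘ₗ g) with hL
  have hx : ∀ x, ‖A *ᵥ x‖ ≤ ‖L‖ * ‖Aᵀ *ᵥ (A *ᵥ x)‖ := fun x => by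
    have h1 : f.rangeRestrict (g (f.rangeRestrict x)) = f.rangeRestrict x :=
      LinearMap.congr_fun hg _
    have h2 : f (g (f.rangeRestrict x)) = f x := congrArg Subtype.val h1
    have h3 : x - g (f.rangeRestrict x) ∈ A.mulVecLin.ker :=
      (ker_mulVecLin_transpose_mul_self A).le (by
        rw [LinearMap.mem_ker, map_sub, ← hf, h2, sub_self])
    rw [LinearMap.mem_ker, map_sub, sub_eq_zero] at h3
    have h4 : A *ᵥ x = L (f.rangeRestrict x) := h3
    have h5 : ‖f.rangeRestrict x‖ = ‖Aᵀ *ᵥ (A *ᵥ x)‖ := by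
      rw [mulVec_mulVec]
      rfl
    rw [← h5, h4]
    exact L.le_opNorm _
  refine ⟨(Fintype.card ι * ‖L‖ ^ 2 + 1)⁻¹, by positivity, fun x => ?_⟩
  rw [inv_mul_le_iff₀ (by positivity)]
  have h0 := dotProduct_self_nonneg (Aᵀ *ᵥ (A *ᵥ x))
  calc (A *ᵥ x) ⬝ᵥ (A *ᵥ x) ≤ Fintype.card ι * ‖A *ᵥ x‖ ^ 2 := dotProduct_self_le_norm_sq _
    _ ≤ Fintype.card ι * (‖L‖ * ‖Aᵀ *ᵥ (A *ᵥ x)‖) ^ 2 := by gcongr; exact hx x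
    _ = Fintype.card ι * ‖L‖ ^ 2 * ‖Aᵀ *ᵥ (A *ᵥ x)‖ ^ 2 := by ring
    _ ≤ Fintype.card ι * ‖L‖ ^ 2 * ((Aᵀ *ᵥ (A *ᵥ x)) ⬝ᵥ (Aᵀ *ᵥ (A *ᵥ x))) := by
        gcongr
        exact norm_sq_le_dotProduct_self _
    _ ≤ _ := by linarith

variable {n : ℕ}

theorem hankel_sub (x y : Fin (2 * n) → ℝ) : Hankel (x - y) = Hankel x - Hankel y := by
  ext i j
  simp [Hankel]

theorem lower_sub (x y : Fin (2 * n) → ℝ) : lower (x - y) = lower x - lower y := rfl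

theorem upper_sub (x y : Fin (2 * n) → ℝ) : upper (x - y) = upper x - upper y := rfl

theorem norm_hankel_mulVec_le (θ : Fin (2 * n) → ℝ) (w : Fin n → ℝ) :
    ‖Hankel θ *ᵥ w‖ ≤ n * n * ‖θ‖ * ‖w‖ := by
  simpa using norm_mulVec_le_of_entries (M := Hankel θ) (c := ‖θ‖)
    (fun i j => norm_le_pi_norm θ _) w

theorem norm_lower_le (θ : Fin (2 * n) → ℝ) : ‖lower θ‖ ≤ ‖θ‖ :=
  (pi_norm_le_iff_of_nonneg (norm_nonneg _)).2 fun _ => norm_le_pi_norm θ _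

theorem norm_upper_le (θ : Fin (2 * n) → ℝ) : ‖upper θ‖ ≤ ‖θ‖ :=
  (pi_norm_le_iff_of_nonneg (norm_nonneg _)).2 fun _ => norm_le_pi_norm θ _

/-- The parameter estimate converges, with a square-integrable error witnessed by an energy. -/
theorem parameter_convergence {a : Fin n → ℝ} {m : Fin (2 * n) → ℝ} {k C : ℝ} (hk : 0 < k)
    (hC : 0 < C) (hm : IsHurwitz (companion m)) {η θ : ℝ → Fin (2 * n) → ℝ}
    {b : ℝ → Fin n → ℝ}
    (hη : ∀ t ∈ Ici (0 : ℝ),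
      HasDerivWithinAt (fun t => η t - θ t) (companion m *ᵥ (η t - θ t)) (Ici 0) t)
    (hθ : ∀ t, Hankel (θ t) *ᵥ a + lower (θ t) = 0)
    (hlow : ∀ t w, ‖w‖ ≤ C * ‖Hankel (θ t) *ᵥ w‖)
    (hb : ∀ t ∈ Ici (0 : ℝ), HasDerivWithinAt b
      (-k • ((Hankel (η t))ᵀ *ᵥ (Hankel (η t) *ᵥ b t + lower (η t)))) (Ici 0) t) :
    Tendsto (fun t => η t - θ t) atTop (𝓝 0) ∧ Tendsto (fun t => b t - a) atTop (𝓝 0) ∧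
      ∃ (E E' : ℝ → ℝ) (T : ℝ), 0 ≤ T ∧ (∀ t, 0 ≤ E t) ∧
        (∀ t ∈ Ici (0 : ℝ), HasDerivWithinAt E (E' t) (Ici 0) t) ∧
        ∀ t, T ≤ t → E' t ≤ -((b t - a) ⬝ᵥ (b t - a)) := by
  have hη0 : Tendsto (fun t => η t - θ t) atTop (𝓝 0) :=
    hm.tendsto_zero (r := fun _ => 0) (fun t ht => by simpa using hη t ht) tendsto_const_nhds
  set ε : ℝ → Fin (2 * n) → ℝ := fun t => η t - θ t with hε
  set w : ℝ → Fin n → ℝ := fun t => b t - a with hw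
  set δ : ℝ → Fin n → ℝ := fun t => Hankel (ε t) *ᵥ a + lower (ε t) with hδ
  set V' : ℝ → ℝ := fun t => 2 * (w t ⬝ᵥ
    (-k • ((Hankel (η t))ᵀ *ᵥ (Hankel (η t) *ᵥ b t + lower (η t))))) with hV'
  have hderiv : ∀ t ∈ Ici (0 : ℝ), HasDerivWithinAt (fun t => w t ⬝ᵥ w t) (V' t) (Ici 0) t :=
    fun t ht => hasDerivWithinAt_dotProduct_self ((hb t ht).sub_const a)
  -- Subtracting the Hankel equation for `a` along `θ` leaves a regression in the parameter error,
  -- disturbed only by the observer transient.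
  have hres : ∀ t, Hankel (η t) *ᵥ b t + lower (η t) = Hankel (η t) *ᵥ w t + δ t := fun t => by
    have h1 : δ t = Hankel (η t) *ᵥ a + lower (η t) := by
      have h2 := hθ t
      simp only [hδ, hε, hankel_sub, lower_sub, sub_mulVec]
      rw [add_eq_zero_iff_eq_neg] at h2
      rw [h2]
      abel
    rw [h1, hw, mulVec_sub]
    abel
  set K := n * ((n : ℝ) * n * ‖a‖ + 1) ^ 2 with hK
  have hδle : ∀ t, δ t ⬝ᵥ δ t ≤ K * (ε t ⬝ᵥ ε t) := fun t => by
    have h1 : ‖δ t‖ ≤ (n * n * ‖a‖ + 1) * ‖ε t‖ := by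
      refine (norm_add_le _ _).trans ?_
      have := norm_hankel_mulVec_le (ε t) a
      have := norm_lower_le (ε t)
      nlinarith
    calc δ t ⬝ᵥ δ t ≤ Fintype.card (Fin n) * ‖δ t‖ ^ 2 := dotProduct_self_le_norm_sq _
      _ ≤ n * ((n * n * ‖a‖ + 1) * ‖ε t‖) ^ 2 := by
          rw [Fintype.card_fin]
          gcongr
      _ = K * ‖ε t‖ ^ 2 := by rw [hK]; ring
      _ ≤ K * (ε t ⬝ᵥ ε t) := by gcongr; exact norm_sq_le_dotProduct_self _
  have hV'le : ∀ t, V' t ≤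
      -k * ((Hankel (η t) *ᵥ w t) ⬝ᵥ (Hankel (η t) *ᵥ w t)) + k * K * (ε t ⬝ᵥ ε t) := fun t => by
    simp only [hV', dotProduct_gradient, hres]
    have h1 := mul_le_mul_of_nonneg_left
      (neg_two_mul_dotProduct_add_le (Hankel (η t) *ᵥ w t) (δ t)) hk.le
    have h2 := mul_le_mul_of_nonneg_left (hδle t) hk.le
    linarith
  -- Replacing `θ` by `η` costs at most half of `‖w‖`, which doubles `C`; squaring gives `4 * C ^
  -- 2`. The factor `n + 1` passes from the sup norm to the dot product and stays positive for `n =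
  -- 0`.
  set c := (4 * C ^ 2 * (n + 1))⁻¹ with hc
  have hc0 : 0 < c := by positivity
  have hexc : ∀ᶠ t in atTop,
      c * (w t ⬝ᵥ w t) ≤ (Hankel (η t) *ᵥ w t) ⬝ᵥ (Hankel (η t) *ᵥ w t) := by
    have h0 := hη0.norm.const_mul (C * (n * n))
    rw [norm_zero, mul_zero] at h0
    filter_upwards [h0.eventually (gt_mem_nhds (show (0 : ℝ) < 1 / 2 by norm_num))] with t ht
    have h1 : Hankel (θ t) *ᵥ w t = Hankel (η t) *ᵥ w t - Hankel (ε t) *ᵥ w t := by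
      rw [hε, hankel_sub, sub_mulVec]
      abel
    have h2 := hlow t (w t)
    rw [h1] at h2
    have h3 : ‖w t‖ ≤ C * ‖Hankel (η t) *ᵥ w t‖ + 1 / 2 * ‖w t‖ := by
      refine h2.trans ((mul_le_mul_of_nonneg_left (norm_sub_le _ _) hC.le).trans ?_)
      have h4 := mul_le_mul_of_nonneg_left (norm_hankel_mulVec_le (ε t) (w t)) hC.le
      have h5 := mul_le_mul_of_nonneg_right ht.le (norm_nonneg (w t))
      linarith
    have h4 : ‖w t‖ ≤ 2 * C * ‖Hankel (η t) *ᵥ w t‖ := by linarith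
    rw [hc, inv_mul_le_iff₀ (by positivity)]
    calc w t ⬝ᵥ w t ≤ Fintype.card (Fin n) * ‖w t‖ ^ 2 := dotProduct_self_le_norm_sq _
      _ ≤ (n + 1) * (2 * C * ‖Hankel (η t) *ᵥ w t‖) ^ 2 := by
          rw [Fintype.card_fin]
          gcongr
          linarith
      _ = 4 * C ^ 2 * (n + 1) * ‖Hankel (η t) *ᵥ w t‖ ^ 2 := by ring
      _ ≤ _ := by gcongr; exact norm_sq_le_dotProduct_self _
  have hdecay : ∀ᶠ t in atTop, V' t ≤ -(k * c) * (w t ⬝ᵥ w t) + k * K * (ε t ⬝ᵥ ε t) :=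
    hexc.mono fun t ht => by
      have h1 := mul_le_mul_of_nonneg_left ht hk.le
      have h2 := hV'le t
      linarith
  have hkc : 0 < k * c := mul_pos hk hc0
  have hw0 : Tendsto w atTop (𝓝 0) := by
    refine tendsto_zero_iff_dotProduct_self.2 (tendsto_zero_of_deriv_le hkc hderiv
      (fun t => dotProduct_self_nonneg _) hdecay ?_)
    simpa using (tendsto_zero_iff_dotProduct_self.1 hη0).const_mul (k * K)
  obtain ⟨P, hP, hPx, D, hD, -, hPM⟩ := hm.exists_lyapunov
  obtain ⟨T, hT⟩ := eventually_atTop.1 hdecay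
  have hK0 : 0 ≤ K := by positivity
  -- The Lyapunov form of the observer decays at least like `-(1 / 2) |ε|²`, so the weight `2 * (k *
  -- K)` cancels the disturbance `k * K * |ε|²`; the factor `(k * c)⁻¹` normalizes the remaining
  -- decay to `|w|²`.
  refine ⟨hη0, hw0, fun t => (k * c)⁻¹ * (w t ⬝ᵥ w t + 2 * (k * K) * (ε t ⬝ᵥ P *ᵥ ε t)),
    fun t => (k * c)⁻¹ *
      (V' t + 2 * (k * K) * (2 * (ε t ⬝ᵥ P *ᵥ (companion m *ᵥ ε t)))),
    max T 0, le_max_right _ _, fun t => ?_, fun t ht => ?_, fun t ht => ?_⟩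
  · have h1 := dotProduct_self_nonneg (w t)
    have h2 := (dotProduct_self_nonneg (ε t)).trans (hPx (ε t))
    positivity
  · exact ((hderiv t ht).add ((hasDerivWithinAt_quadratic hP (hη t ht)).const_mul _)).const_mul _
  · have h1 := hT t ((le_max_left _ _).trans ht)
    have h2 := hPM (ε t) 0
    rw [add_zero, dotProduct_zero, mul_zero, add_zero] at h2
    have h3 := mul_le_mul_of_nonneg_left h2 (show 0 ≤ 2 * (k * K) by positivity)
    rw [inv_mul_le_iff₀ hkc]
    linarith

/-- The gradient flow for a linear equation with a convergent coefficient matrix is bounded and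
its residuals vanish, provided that the limit equation is solvable and that the error of the
coefficients is square integrable, as witnessed by an energy. -/
theorem gradient_convergence [DecidableEq κ] {A : ℝ → Matrix κ κ ℝ} {A₀ : Matrix κ κ ℝ}
    {β : κ → ℝ} {k : ℝ} (hk : 0 < k) {w : ℝ → ι → ℝ} (hw : Tendsto w atTop (𝓝 0))
    (hA : ∀ t i j, ‖(A t - A₀) i j‖ ≤ ‖w t‖) (hsol : ∃ x, A₀ *ᵥ x = β)
    {E E' : ℝ → ℝ} {T : ℝ} (hT : 0 ≤ T) (hE0 : ∀ t, 0 ≤ E t)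
    (hE : ∀ t ∈ Ici (0 : ℝ), HasDerivWithinAt E (E' t) (Ici 0) t)
    (hE' : ∀ t, T ≤ t → E' t ≤ -(w t ⬝ᵥ w t)) {ζ : ℝ → κ → ℝ}
    (hζ : ∀ t ∈ Ici (0 : ℝ),
      HasDerivWithinAt ζ (-k • ((A t)ᵀ *ᵥ (A t *ᵥ ζ t - β))) (Ici 0) t) :
    (∃ c, ∀ t ∈ Ici (0 : ℝ), ‖ζ t‖ ≤ c) ∧
      Tendsto (fun t => A t *ᵥ ζ t - β) atTop (𝓝 0) ∧
      Tendsto (fun t => A₀ *ᵥ ζ t - β) atTop (𝓝 0) := by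
  obtain ⟨x, hx⟩ := hsol
  have hA0 : Tendsto (fun t => A t - A₀) atTop (𝓝 0) := by
    have h0 := hw.norm
    rw [norm_zero] at h0
    exact tendsto_pi_nhds.2 fun i => tendsto_pi_nhds.2 fun j =>
      squeeze_zero_norm (fun t => hA t i j) h0
  have hcont : ContinuousOn ζ (Ici 0) := fun t ht => (hζ t ht).continuousWithinAt
  set K : ℝ := Fintype.card κ * (Fintype.card κ * Fintype.card κ * ‖x‖) ^ 2 with hK
  have hδ : ∀ t, ((A t - A₀) *ᵥ x) ⬝ᵥ ((A t - A₀) *ᵥ x) ≤ K * (w t ⬝ᵥ w t) := fun t => by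
    calc ((A t - A₀) *ᵥ x) ⬝ᵥ ((A t - A₀) *ᵥ x)
        ≤ Fintype.card κ * ‖(A t - A₀) *ᵥ x‖ ^ 2 := dotProduct_self_le_norm_sq _
      _ ≤ Fintype.card κ * (Fintype.card κ * Fintype.card κ * ‖w t‖ * ‖x‖) ^ 2 := by
          gcongr
          exact norm_mulVec_le_of_entries (hA t) x
      _ = K * ‖w t‖ ^ 2 := by rw [hK]; ring
      _ ≤ _ := by gcongr; exact norm_sq_le_dotProduct_self _
  have hderiv : ∀ t ∈ Ici (0 : ℝ), HasDerivWithinAt (fun t => (ζ t - x) ⬝ᵥ (ζ t - x))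
      (2 * ((ζ t - x) ⬝ᵥ (-k • ((A t)ᵀ *ᵥ (A t *ᵥ ζ t - β))))) (Ici 0) t :=
    fun t ht => hasDerivWithinAt_dotProduct_self ((hζ t ht).sub_const x)
  have hle : ∀ t, 2 * ((ζ t - x) ⬝ᵥ (-k • ((A t)ᵀ *ᵥ (A t *ᵥ ζ t - β)))) ≤
      k * K * (w t ⬝ᵥ w t) := fun t => by
    have h1 : A t *ᵥ ζ t - β = A t *ᵥ (ζ t - x) + (A t - A₀) *ᵥ x := by
      rw [mulVec_sub, sub_mulVec, hx]
      abel
    rw [dotProduct_gradient, h1, mul_assoc]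
    refine mul_le_mul_of_nonneg_left ((neg_two_mul_dotProduct_add_le _ _).trans ?_) hk.le
    have := dotProduct_self_nonneg (A t *ᵥ (ζ t - x))
    linarith [hδ t]
  -- The distance to a limit solution `x` can grow at most at rate `k * K * |w|²`, which the
  -- decreasing energy `k * K * E` pays for. This bounds `ζ`.
  have hanti := antitoneOn_of_hasDerivWithinAt_nonpos hT
    (fun t ht => (hderiv t ht).add ((hE t ht).const_mul (k * K))) fun t ht => by
      have h1 := mul_le_mul_of_nonneg_left (hE' t ht) (show 0 ≤ k * K by positivity)
      linarith [hle t]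
  obtain ⟨c, hc⟩ : ∃ c, ∀ t ∈ Ici (0 : ℝ), ‖ζ t‖ ≤ c := by
    set R := (ζ T - x) ⬝ᵥ (ζ T - x) + k * K * E T
    refine exists_norm_le_of_eventually hcont (c := √R + ‖x‖) ?_
    filter_upwards [eventually_ge_atTop T] with t ht
    have h1 := hanti (mem_Ici.2 le_rfl) ht ht
    have h2 : 0 ≤ k * K * E t := mul_nonneg (by positivity) (hE0 t)
    have h3 : ‖ζ t - x‖ ^ 2 ≤ R := by
      have h3 := norm_sq_le_dotProduct_self (ζ t - x)
      simp only [Pi.add_apply] at h1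
      linarith
    have h4 := Real.le_sqrt_of_sq_le h3
    have h5 := norm_le_norm_sub_add (ζ t) x
    linarith
  have hdiff : Tendsto (fun t => (A t - A₀) *ᵥ ζ t) atTop (𝓝 0) :=
    tendsto_mulVec_zero_of_bounded_vec (c := c) hA0
      ((eventually_ge_atTop 0).mono fun t ht => hc t ht)
  set z : ℝ → κ → ℝ := fun t => A₀ *ᵥ ζ t - β with hz
  have hzw : ∀ t, A t *ᵥ ζ t - β = z t + (A t - A₀) *ᵥ ζ t := fun t => by
    simp only [hz, sub_mulVec]
    abel
  -- With this `r` the limit residual obeys `z' = -k A₀ (A₀ᵀ z + r)`, a gradient flow with vanishing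
  -- disturbance.
  set r : ℝ → κ → ℝ := fun t => (A t - A₀)ᵀ *ᵥ (A t *ᵥ ζ t - β) +
    A₀ᵀ *ᵥ ((A t - A₀) *ᵥ ζ t) with hr
  have hr0 : Tendsto r atTop (𝓝 0) := by
    have hT0 : Tendsto (fun t => (A t - A₀)ᵀ) atTop (𝓝 0) := by
      have h := (continuous_id.matrix_transpose.tendsto (0 : Matrix κ κ ℝ)).comp hA0
      rwa [id, transpose_zero] at h
    have h2 := tendsto_mulVec (tendsto_const_nhds (x := A₀ᵀ)) hdiff
    have h1 : Tendsto (fun t => (A t - A₀)ᵀ *ᵥ (A t *ᵥ ζ t - β)) atTop (𝓝 0) := by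
      set K₀ := ∑ i, ∑ j, ‖A₀ i j‖
      refine tendsto_mulVec_zero_of_bounded_vec (c := K₀ * c + ‖β‖ + 1) hT0 ?_
      have h3 := hdiff.norm
      rw [norm_zero] at h3
      filter_upwards [eventually_ge_atTop 0, h3.eventually (gt_mem_nhds one_pos)] with t ht ht1
      have h4 : ‖z t‖ ≤ K₀ * c + ‖β‖ := (norm_sub_le _ _).trans (add_le_add
        ((norm_mulVec_le A₀ _).trans (mul_le_mul_of_nonneg_left (hc t ht)
          (Finset.sum_nonneg fun i _ => Finset.sum_nonneg fun j _ => norm_nonneg _))) le_rfl)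
      rw [hzw]
      exact (norm_add_le _ _).trans (add_le_add h4 ht1.le)
    have h3 := h1.add h2
    rwa [mulVec_zero, add_zero] at h3
  have hstep : ∀ t, (A t)ᵀ *ᵥ (A t *ᵥ ζ t - β) = A₀ᵀ *ᵥ z t + r t := fun t => by
    have h1 : z t = (A t *ᵥ ζ t - β) - (A t - A₀) *ᵥ ζ t := by rw [hzw]; abel
    simp only [h1, hr, transpose_sub, sub_mulVec, mulVec_sub]
    abel
  have hz0 : Tendsto z atTop (𝓝 0) := by
    obtain ⟨c₀, hc₀, hgram⟩ := exists_dotProduct_self_le_gram A₀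
    refine tendsto_zero_iff_dotProduct_self.2 (tendsto_zero_of_deriv_le
      (α := k * c₀) (ρ := fun t => k * (r t ⬝ᵥ r t)) (mul_pos hk hc₀)
      (fun t ht => hasDerivWithinAt_dotProduct_self
        ((hasDerivWithinAt_mulVec A₀ (hζ t ht)).sub_const β))
      (fun t => dotProduct_self_nonneg _) (Eventually.of_forall fun t => ?_) ?_)
    -- Solvability of the limit equation places `z` in the range of `A₀`, where `A₀ᵀ` is bounded
    -- below.
    · have h1 : z t = A₀ *ᵥ (ζ t - x) := by rw [hz, mulVec_sub, hx]
      have h2 := hgram (ζ t - x)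
      rw [← h1] at h2
      have h3 : 2 * (z t ⬝ᵥ (A₀ *ᵥ (-k • ((A t)ᵀ *ᵥ (A t *ᵥ ζ t - β))))) =
          k * (-2 * ((A₀ᵀ *ᵥ z t) ⬝ᵥ (A₀ᵀ *ᵥ z t + r t))) := by
        rw [hstep]
        have h4 := dotProduct_gradient A₀ᵀ (z t) (A₀ᵀ *ᵥ z t + r t) k
        rwa [transpose_transpose, ← mulVec_smul] at h4
      refine h3.trans_le ?_
      have h5 := mul_le_mul_of_nonneg_left
        (neg_two_mul_dotProduct_add_le (A₀ᵀ *ᵥ z t) (r t)) hk.le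
      have h6 := mul_le_mul_of_nonneg_left h2 hk.le
      linarith
    · simpa using (tendsto_zero_iff_dotProduct_self.1 hr0).const_mul k
  refine ⟨⟨c, hc⟩, ?_, hz0⟩
  simp only [hzw]
  simpa using hz0.add hdiff

end Adaptation

/-! ### Vectorized regulator equations -/

section Regulator

variable {nx n : ℕ}

theorem vec_fromRows_hat (ζ : Fin n × (Fin nx ⊕ Fin 1) → ℝ) :
    vec (fromRows (Xhat ζ) (Uhat ζ)) = ζ := by
  funext ⟨j, i⟩
  cases i <;> rfl

theorem regulatorMatrix_mulVec_vec_sub (p : Plant nx n) (a : Fin n → ℝ)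
    (X : Matrix (Fin nx) (Fin n) ℝ) (U : Matrix (Fin 1) (Fin n) ℝ) :
    p.regulatorMatrix a *ᵥ vec (fromRows X U) - p.regulatorVector =
      vec (fromRows (X * companion a - (p.A * X + p.B * U + p.P))
        (-(p.C * X + p.D * U + p.F))) := by
  rw [Plant.regulatorMatrix, Plant.regulatorVector, sub_mulVec, kronecker_mulVec_vec,
    kronecker_mulVec_vec, transpose_transpose, transpose_one, Matrix.mul_one, ← vec_sub,
    ← vec_sub, vec_inj]
  ext i j
  rcases i with i | i
  · simp [fromBlocks_mul_fromRows, fromRows_mul]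
    ring
  · simp [fromBlocks_mul_fromRows, fromRows_mul]
    ring

theorem xhat_residual (p : Plant nx n) (a : Fin n → ℝ) (ζ : Fin n × (Fin nx ⊕ Fin 1) → ℝ) :
    Xhat (p.regulatorMatrix a *ᵥ ζ - p.regulatorVector) =
      Xhat ζ * companion a - (p.A * Xhat ζ + p.B * Uhat ζ + p.P) := by
  conv_lhs => rw [← vec_fromRows_hat ζ, regulatorMatrix_mulVec_vec_sub]
  rfl

theorem uhat_residual (p : Plant nx n) (a : Fin n → ℝ) (ζ : Fin n × (Fin nx ⊕ Fin 1) → ℝ) :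
    Uhat (p.regulatorMatrix a *ᵥ ζ - p.regulatorVector) =
      -(p.C * Xhat ζ + p.D * Uhat ζ + p.F) := by
  conv_lhs => rw [← vec_fromRows_hat ζ, regulatorMatrix_mulVec_vec_sub]
  rfl

theorem Plant.IsRegulatorSolution.exists_mulVec_eq {p : Plant nx n} {a : Fin n → ℝ}
    {X : Matrix (Fin nx) (Fin n) ℝ} {U : Matrix (Fin 1) (Fin n) ℝ}
    (h : p.IsRegulatorSolution a X U) : ∃ ζ, p.regulatorMatrix a *ᵥ ζ = p.regulatorVector := by
  refine ⟨vec (fromRows X U), sub_eq_zero.1 ?_⟩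
  rw [regulatorMatrix_mulVec_vec_sub, h.1, ← h.2, sub_self, neg_zero, vec_eq_zero_iff]
  ext i j
  cases i <;> rfl

/-- Only the last companion row depends on the parameter, and the Kronecker factor multiplying it
has entries `0` and `1`. -/
theorem norm_regulatorMatrix_sub_le (p : Plant nx n) (a b : Fin n → ℝ) (i j) :
    ‖(p.regulatorMatrix b - p.regulatorMatrix a) i j‖ ≤ ‖b - a‖ := by
  obtain ⟨i₁, i₂⟩ := i
  obtain ⟨j₁, j₂⟩ := j
  have h1 : (p.regulatorMatrix b - p.regulatorMatrix a) (i₁, i₂) (j₁, j₂) =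
      (companion b j₁ i₁ - companion a j₁ i₁) *
        (fromBlocks 1 0 0 0 : Matrix (Fin nx ⊕ Fin 1) (Fin nx ⊕ Fin 1) ℝ) i₂ j₂ := by
    simp only [Plant.regulatorMatrix, Matrix.sub_apply, kroneckerMap_apply, transpose_apply]
    ring
  have h2 : ‖companion b j₁ i₁ - companion a j₁ i₁‖ ≤ ‖b - a‖ := by
    simp only [companion, of_apply]
    split_ifs
    · rw [neg_sub_neg, ← norm_neg, neg_sub]
      exact norm_le_pi_norm (b - a) i₁
    · simp
    · simp
  have h3 : ‖(fromBlocks 1 0 0 0 : Matrix (Fin nx ⊕ Fin 1) (Fin nx ⊕ Fin 1) ℝ) i₂ j₂‖ ≤ 1 := by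
    rcases i₂ with i | i <;> rcases j₂ with j | j
    · simp only [fromBlocks_apply₁₁, one_apply]
      split_ifs <;> simp
    · simp
    · simp
    · simp
  rw [h1, norm_mul]
  exact (mul_le_mul h2 h3 (norm_nonneg _) (norm_nonneg _)).trans_eq (mul_one _)

/-! ### Continuity of the coefficients and existence of closed-loop solutions -/

theorem continuous_companion {k : ℕ} :
    Continuous (companion : (Fin k → ℝ) → Matrix (Fin k) (Fin k) ℝ) := by
  refine continuous_matrix fun i j => ?_
  simp only [companion, of_apply]
  split_ifs
  · exact (continuous_apply j).neg
  · exact continuous_const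
  · exact continuous_const

theorem continuous_xi (m : Fin (2 * n) → ℝ) : Continuous (Xi m) :=
  (continuous_companion.pow _).add
    (continuous_finsetSum _ fun j _ => (continuous_companion.pow j.val).const_smul (m j))

theorem continuous_hankel : Continuous (Hankel : (Fin (2 * n) → ℝ) → Matrix (Fin n) (Fin n) ℝ) :=
  continuous_matrix fun _ _ => continuous_apply _

theorem continuous_lower : Continuous (lower : (Fin (2 * n) → ℝ) → Fin n → ℝ) :=
  continuous_pi fun _ => continuous_apply _

theorem continuous_upper : Continuous (upper : (Fin (2 * n) → ℝ) → Fin n → ℝ) :=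
  continuous_pi fun _ => continuous_apply _

theorem continuous_xhat :
    Continuous (Xhat : (Fin n × (Fin nx ⊕ Fin 1) → ℝ) → Matrix (Fin nx) (Fin n) ℝ) :=
  continuous_matrix fun _ _ => continuous_apply _

theorem continuous_uhat :
    Continuous (Uhat : (Fin n × (Fin nx ⊕ Fin 1) → ℝ) → Matrix (Fin 1) (Fin n) ℝ) :=
  continuous_matrix fun _ _ => continuous_apply _

theorem continuous_regulatorMatrix (p : Plant nx n) : Continuous p.regulatorMatrix := by
  refine continuous_matrix fun i j => ?_
  simp only [Plant.regulatorMatrix, Matrix.sub_apply, kroneckerMap_apply, transpose_apply]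
  exact ((continuous_companion.matrix_elem _ _).mul continuous_const).sub continuous_const

theorem continuous_plantForcing (p : Plant nx n) (g : Design nx n) :
    Continuous fun q : (Fin n × (Fin nx ⊕ Fin 1) → ℝ) × (Fin n → ℝ) ×
      (Fin (2 * n) → ℝ) × (Fin n → ℝ) =>
      p.B *ᵥ (((Uhat q.1 - g.Kx * Xhat q.1) * Xi g.m q.2.1) *ᵥ upper q.2.2.1) +
        p.P *ᵥ q.2.2.2 := by
  have h1 := continuous_uhat.comp (continuous_fst (X := Fin n × (Fin nx ⊕ Fin 1) → ℝ)
    (Y := (Fin n → ℝ) × (Fin (2 * n) → ℝ) × (Fin n → ℝ)))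
  have h2 := continuous_xhat.comp (continuous_fst (X := Fin n × (Fin nx ⊕ Fin 1) → ℝ)
    (Y := (Fin n → ℝ) × (Fin (2 * n) → ℝ) × (Fin n → ℝ)))
  have h3 := (h1.sub (continuous_const (y := g.Kx) |>.matrix_mul h2)).matrix_mul
    ((continuous_xi g.m).comp (continuous_fst.comp continuous_snd))
  have h4 := h3.matrix_mulVec
    (continuous_upper.comp (continuous_fst.comp (continuous_snd.comp continuous_snd)))
  exact ((continuous_const (y := p.B)).matrix_mulVec h4).add
    ((continuous_const (y := p.P)).matrix_mulVec
      (continuous_snd.comp (continuous_snd.comp continuous_snd)))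

/-- Solve the cascade in the order `v`, `η`, `ahat`, `ζ`, `x`; with the earlier signals known, each
equation is linear with continuous coefficients. -/
theorem exists_closedLoopSolution (p : Plant nx n) (g : Design nx n) (a : Fin n → ℝ)
    (v₀ : Fin n → ℝ) (x₀ : Fin nx → ℝ) (η₀ : Fin (2 * n) → ℝ) (a₀ : Fin n → ℝ)
    (ζ₀ : Fin n × (Fin nx ⊕ Fin 1) → ℝ) :
    ∃ s : Signals nx n, s.IsClosedLoopSolution p g a ∧
      s.v 0 = v₀ ∧ s.x 0 = x₀ ∧ s.η 0 = η₀ ∧ s.ahat 0 = a₀ ∧ s.ζ 0 = ζ₀ := by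
  have cont : ∀ {ι : Type} [Fintype ι] {y y' : ℝ → ι → ℝ},
      (∀ t ∈ Ici (0 : ℝ), HasDerivWithinAt y (y' t) (Ici 0) t) → ContinuousOn y (Ici 0) :=
    fun h t ht => (h t ht).continuousWithinAt
  obtain ⟨v, hv0, hv⟩ := exists_linearODE (A := fun _ => companion a) (b := fun _ => 0)
    continuousOn_const continuousOn_const v₀
  have hvc := cont hv
  obtain ⟨η, hη0, hη⟩ := exists_linearODE (A := fun _ => companion g.m)
    (b := fun t => Nvec n *ᵥ (Gam n *ᵥ v t)) continuousOn_const
    ((continuous_const.matrix_mulVec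
      (continuous_const.matrix_mulVec continuous_id)).comp_continuousOn hvc) η₀
  have hηc := cont hη
  have hHA : Continuous fun θ : Fin (2 * n) → ℝ => -g.k₁ • ((Hankel θ)ᵀ * Hankel θ) :=
    (continuous_hankel.matrix_transpose.matrix_mul continuous_hankel).const_smul (-g.k₁)
  have hHb : Continuous fun θ : Fin (2 * n) → ℝ => -g.k₁ • ((Hankel θ)ᵀ *ᵥ lower θ) :=
    (continuous_hankel.matrix_transpose.matrix_mulVec continuous_lower).const_smul (-g.k₁)
  obtain ⟨b, hb0, hb⟩ := exists_linearODE
    (A := fun t => -g.k₁ • ((Hankel (η t))ᵀ * Hankel (η t)))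
    (b := fun t => -g.k₁ • ((Hankel (η t))ᵀ *ᵥ lower (η t)))
    (hHA.comp_continuousOn hηc) (hHb.comp_continuousOn hηc) a₀
  have hbc := cont hb
  have hreg := continuous_regulatorMatrix p
  have hRA : Continuous fun b : Fin n → ℝ =>
      -g.k₂ • ((p.regulatorMatrix b)ᵀ * p.regulatorMatrix b) :=
    (hreg.matrix_transpose.matrix_mul hreg).const_smul (-g.k₂)
  have hRb : Continuous fun b : Fin n → ℝ =>
      -g.k₂ • ((p.regulatorMatrix b)ᵀ *ᵥ (-p.regulatorVector)) :=
    (hreg.matrix_transpose.matrix_mulVec continuous_const).const_smul (-g.k₂)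
  obtain ⟨ζ, hζ0, hζ⟩ := exists_linearODE
    (A := fun t => -g.k₂ • ((p.regulatorMatrix (b t))ᵀ * p.regulatorMatrix (b t)))
    (b := fun t => -g.k₂ • ((p.regulatorMatrix (b t))ᵀ *ᵥ (-p.regulatorVector)))
    (hRA.comp_continuousOn hbc) (hRb.comp_continuousOn hbc) ζ₀
  have hζc := cont hζ
  have hxf : ContinuousOn (fun t =>
      p.B *ᵥ (((Uhat (ζ t) - g.Kx * Xhat (ζ t)) * Xi g.m (b t)) *ᵥ upper (η t)) + p.P *ᵥ v t)
      (Ici 0) :=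
    (continuous_plantForcing p g).comp_continuousOn (f := fun t => (ζ t, b t, η t, v t))
      (hζc.prodMk (hbc.prodMk (hηc.prodMk hvc)))
  obtain ⟨x, hx0, hx⟩ := exists_linearODE (A := fun _ => p.A + p.B * g.Kx)
    continuousOn_const hxf x₀
  refine ⟨⟨v, x, η, b, ζ⟩, ⟨fun t ht => ?_, fun t ht => ?_, fun t ht => ?_, fun t ht => ?_,
    fun t ht => ?_⟩, hv0, hx0, hη0, hb0, hζ0⟩
  · simpa using hv t ht
  · refine (hx t ht).congr_deriv ?_
    simp only [Signals.u, Design.input, add_mulVec, mulVec_add, mulVec_mulVec]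
    abel
  · exact hη t ht
  · refine (hb t ht).congr_deriv ?_
    simp only [mulVec_add, smul_add, smul_mulVec, mulVec_mulVec]
  · refine (hζ t ht).congr_deriv ?_
    simp only [sub_eq_add_neg, mulVec_add, smul_add, smul_mulVec, mulVec_mulVec]

/-! ### Boundedness and regulation of the closed loop -/

theorem norm_xhat_le (ζ : Fin n × (Fin nx ⊕ Fin 1) → ℝ) (i j) : ‖Xhat ζ i j‖ ≤ ‖ζ‖ :=
  norm_le_pi_norm ζ _

theorem norm_uhat_le (ζ : Fin n × (Fin nx ⊕ Fin 1) → ℝ) (i j) : ‖Uhat ζ i j‖ ≤ ‖ζ‖ :=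
  norm_le_pi_norm ζ _

theorem hasDerivWithinAt_xhat_mulVec {ζ : ℝ → Fin n × (Fin nx ⊕ Fin 1) → ℝ}
    {ζ' : Fin n × (Fin nx ⊕ Fin 1) → ℝ} {v : ℝ → Fin n → ℝ} {v' : Fin n → ℝ} {s : Set ℝ} {t : ℝ}
    (hζ : HasDerivWithinAt ζ ζ' s t) (hv : HasDerivWithinAt v v' s t) :
    HasDerivWithinAt (fun t => Xhat (ζ t) *ᵥ v t) (Xhat ζ' *ᵥ v t + Xhat (ζ t) *ᵥ v') s t := by
  refine hasDerivWithinAt_pi.2 fun i => ?_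
  have h := HasDerivWithinAt.fun_sum (u := Finset.univ) fun j (_ : j ∈ Finset.univ) =>
    (hasDerivWithinAt_pi.1 hζ (j, Sum.inl i)).mul (hasDerivWithinAt_pi.1 hv j)
  rw [Finset.sum_add_distrib] at h
  exact h

/-- The moving target `X̂ v` replaces a fixed solution `X v`: its extra derivative `X̂' v` vanishes
because the gradient does, and its failure to solve the regulator equations is the vanishing
residual. -/
theorem closedLoop_regulation {p : Plant nx n} {g : Design nx n} {a : Fin n → ℝ}
    (hg : g.IsAdmissible p) (hreg : ∃ X U, p.IsRegulatorSolution a X U) {s : Signals nx n}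
    (hs : s.IsClosedLoopSolution p g a) (hy : IsMultiTone n s.y₀) :
    s.IsBounded ∧ Tendsto (s.e p g) atTop (𝓝 0) := by
  obtain ⟨X, U, hXU⟩ := hreg
  obtain ⟨θ, C, hC, hθ', hθ, hΞ, hlow, hθC, hvC⟩ :=
    exists_steadyState hg.observer hs.exosystem hy
  have hηθ : ∀ t ∈ Ici (0 : ℝ), HasDerivWithinAt (fun t => s.η t - θ t)
      (companion g.m *ᵥ (s.η t - θ t)) (Ici 0) t := fun t ht => by
    refine ((hs.observer t ht).sub (hθ' t ht)).congr_deriv ?_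
    rw [mulVec_sub, Signals.y₀]
    abel
  obtain ⟨hη0, ha0, E, E', T, hT, hE0, hE, hE'⟩ :=
    parameter_convergence hg.k₁_pos hC hg.observer hηθ hθ hlow hs.parameter
  obtain ⟨⟨cζ, hcζ⟩, hw0, hz0⟩ := gradient_convergence hg.k₂_pos ha0
    (fun t => norm_regulatorMatrix_sub_le p a (s.ahat t)) hXU.exists_mulVec_eq hT hE0 hE hE'
    hs.regulator
  have hatend : Tendsto s.ahat atTop (𝓝 a) := by
    simpa using ha0.add_const a
  have hvev : ∀ᶠ t in atTop, ‖s.v t‖ ≤ C := (eventually_ge_atTop 0).mono hvC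
  have hζev : ∀ᶠ t in atTop, ‖s.ζ t‖ ≤ cζ := (eventually_ge_atTop 0).mono hcζ
  have hXev : ∀ᶠ t in atTop, ∀ i j, ‖Xhat (s.ζ t) i j‖ ≤ cζ :=
    hζev.mono fun t ht i j => (norm_xhat_le _ i j).trans ht
  have hUev : ∀ᶠ t in atTop, ∀ i j, ‖Uhat (s.ζ t) i j‖ ≤ cζ :=
    hζev.mono fun t ht i j => (norm_uhat_le _ i j).trans ht
  -- the reconstruction error of the exosystem state
  set ξ : ℝ → Fin n → ℝ := fun t => Xi g.m (s.ahat t) *ᵥ upper (s.η t) - s.v t with hξ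
  have hξ0 : Tendsto ξ atTop (𝓝 0) := by
    have hΞt := ((continuous_xi g.m).tendsto a).comp hatend
    -- The reconstruction error splits into the observer transient and the error of `Ξ(ahat)` on the
    -- bounded steady state, since `Ξ(a)` maps the steady state to `v`.
    have h1 : Tendsto (fun t => Xi g.m (s.ahat t) *ᵥ upper (s.η t - θ t)) atTop (𝓝 0) := by
      have h := tendsto_mulVec hΞt ((continuous_upper.tendsto _).comp hη0)
      have h0 : upper (0 : Fin (2 * n) → ℝ) = 0 := rfl
      rwa [h0, mulVec_zero] at h
    have h2 : Tendsto (fun t => (Xi g.m (s.ahat t) - Xi g.m a) *ᵥ upper (θ t)) atTop (𝓝 0) :=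
      tendsto_mulVec_zero_of_bounded_vec (c := C)
        (by simpa using hΞt.sub_const (Xi g.m a))
        (Eventually.of_forall fun t => (norm_upper_le _).trans (hθC t))
    have h3 := h1.add h2
    rw [add_zero] at h3
    refine h3.congr' ((eventually_ge_atTop 0).mono fun t ht => ?_)
    simp only [hξ, upper_sub, mulVec_sub, sub_mulVec, hΞ t ht]
    abel
  have hUXξ : Tendsto (fun t => (Uhat (s.ζ t) - g.Kx * Xhat (s.ζ t)) *ᵥ ξ t) atTop (𝓝 0) := by
    have h1 := tendsto_mulVec_zero_of_bounded_matrix hUev hξ0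
    have h2 := tendsto_mulVec (tendsto_const_nhds (x := g.Kx))
      (tendsto_mulVec_zero_of_bounded_matrix hXev hξ0)
    have h3 := h1.sub h2
    rw [mulVec_zero, sub_zero] at h3
    simpa only [sub_mulVec, ← mulVec_mulVec] using h3
  have hu : ∀ t, s.u g t = g.Kx *ᵥ s.x t +
      ((Uhat (s.ζ t) - g.Kx * Xhat (s.ζ t)) *ᵥ ξ t +
        (Uhat (s.ζ t) - g.Kx * Xhat (s.ζ t)) *ᵥ s.v t) := fun t => by
    rw [Signals.u, Design.input, ← mulVec_add, hξ, sub_add_cancel, mulVec_mulVec]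
  set z : ℝ → Fin n × (Fin nx ⊕ Fin 1) → ℝ :=
    fun t => p.regulatorMatrix a *ᵥ s.ζ t - p.regulatorVector with hz
  set ζ' : ℝ → Fin n × (Fin nx ⊕ Fin 1) → ℝ := fun t =>
    -g.k₂ • ((p.regulatorMatrix (s.ahat t))ᵀ *ᵥ
      (p.regulatorMatrix (s.ahat t) *ᵥ s.ζ t - p.regulatorVector)) with hζ'
  have hζ'0 : Tendsto ζ' atTop (𝓝 0) := by
    have h1 := tendsto_mulVec
      (((continuous_regulatorMatrix p).matrix_transpose.tendsto a).comp hatend) hw0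
    have h2 := h1.const_smul (-g.k₂)
    rwa [mulVec_zero, smul_zero] at h2
  have hXz : Tendsto (fun t => Xhat (z t) *ᵥ s.v t) atTop (𝓝 0) :=
    tendsto_mulVec_zero_of_bounded_vec ((continuous_xhat.tendsto 0).comp hz0) hvev
  have hUz : Tendsto (fun t => Uhat (z t) *ᵥ s.v t) atTop (𝓝 0) :=
    tendsto_mulVec_zero_of_bounded_vec ((continuous_uhat.tendsto 0).comp hz0) hvev
  have hXζ' : Tendsto (fun t => Xhat (ζ' t) *ᵥ s.v t) atTop (𝓝 0) :=
    tendsto_mulVec_zero_of_bounded_vec ((continuous_xhat.tendsto 0).comp hζ'0) hvev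
  -- The input to the error equation of `x - X̂ v`: the reconstruction error through the gains, the
  -- residual of the Sylvester equation, and the drift of `X̂`.
  set r : ℝ → Fin nx → ℝ := fun t =>
    p.B *ᵥ ((Uhat (s.ζ t) - g.Kx * Xhat (s.ζ t)) *ᵥ ξ t) - Xhat (z t) *ᵥ s.v t -
      Xhat (ζ' t) *ᵥ s.v t with hr
  have hr0 : Tendsto r atTop (𝓝 0) := by
    have h := ((tendsto_mulVec (tendsto_const_nhds (x := p.B)) hUXξ).sub hXz).sub hXζ'
    rwa [mulVec_zero, sub_zero, sub_zero] at h
  have hx0 : Tendsto (fun t => s.x t - Xhat (s.ζ t) *ᵥ s.v t) atTop (𝓝 0) := by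
    refine hg.feedback.tendsto_zero (r := r) (fun t ht => ?_) hr0
    refine ((hs.plant t ht).sub
      (hasDerivWithinAt_xhat_mulVec (hs.regulator t ht) (hs.exosystem t ht))).congr_deriv ?_
    rw [hu]
    change _ - (Xhat (ζ' t) *ᵥ s.v t + _) = _
    simp only [hr, hz, xhat_residual]
    simp only [add_mulVec, sub_mulVec, mulVec_add, mulVec_sub, ← mulVec_mulVec]
    abel
  have he : ∀ t, s.e p g t = (p.C + p.D * g.Kx) *ᵥ (s.x t - Xhat (s.ζ t) *ᵥ s.v t) +
      p.D *ᵥ ((Uhat (s.ζ t) - g.Kx * Xhat (s.ζ t)) *ᵥ ξ t) - Uhat (z t) *ᵥ s.v t := fun t => by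
    rw [Signals.e, hu]
    simp only [hz, uhat_residual]
    simp only [add_mulVec, sub_mulVec, neg_mulVec, mulVec_add, mulVec_sub, ← mulVec_mulVec]
    abel
  refine ⟨?_, ?_⟩
  · obtain ⟨c₁, hc₁⟩ := exists_norm_le_of_eventually (f := s.η) (c := 1 + C)
      (fun t ht => (hs.observer t ht).continuousWithinAt) (by
        have h := hη0.norm
        rw [norm_zero] at h
        filter_upwards [h.eventually (gt_mem_nhds one_pos)] with t ht
        exact (norm_le_norm_sub_add _ _).trans (add_le_add ht.le (hθC t)))
    obtain ⟨c₂, hc₂⟩ := exists_norm_le_of_eventually (f := s.ahat) (c := ‖a‖ + 1)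
      (fun t ht => (hs.parameter t ht).continuousWithinAt)
      ((hatend.norm.eventually (gt_mem_nhds (lt_add_one _))).mono fun t ht => le_of_lt ht)
    obtain ⟨c₃, hc₃⟩ := exists_norm_le_of_eventually (f := s.x)
      (c := 1 + nx * n * cζ * C)
      (fun t ht => (hs.plant t ht).continuousWithinAt) (by
        have h := hx0.norm
        rw [norm_zero] at h
        filter_upwards [h.eventually (gt_mem_nhds one_pos), hXev, hvev, hζev]
          with t ht hX hv hζ
        refine (norm_le_norm_sub_add _ (Xhat (s.ζ t) *ᵥ s.v t)).trans (add_le_add ht.le ?_)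
        refine (norm_mulVec_le_of_entries hX (s.v t)).trans ?_
        rw [Fintype.card_fin, Fintype.card_fin]
        have : 0 ≤ cζ := (norm_nonneg _).trans hζ
        exact mul_le_mul_of_nonneg_left hv (by positivity))
    refine ⟨max C (max c₃ (max c₁ (max c₂ cζ))), fun t ht => ?_⟩
    simp only [le_max_iff]
    exact ⟨Or.inl (hvC t ht), Or.inr (Or.inl (hc₃ t ht)), Or.inr (Or.inr (Or.inl (hc₁ t ht))),
      Or.inr (Or.inr (Or.inr (Or.inl (hc₂ t ht)))),
      Or.inr (Or.inr (Or.inr (Or.inr (hcζ t ht))))⟩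
  · have h := ((tendsto_mulVec (tendsto_const_nhds (x := p.C + p.D * g.Kx)) hx0).add
      (tendsto_mulVec (tendsto_const_nhds (x := p.D)) hUXξ)).sub hUz
    rw [mulVec_zero, mulVec_zero, add_zero, sub_zero] at h
    exact h.congr fun t => (he t).symm

end Regulator

end FeedforwardRegulation

theorem mainTheorem6 {nx n r : ℕ} (p : FeedforwardRegulation.Plant nx n)
    (S : Set (Fin r → ℝ)) (a : (Fin r → ℝ) → Fin n → ℝ)
    (hS : ∀ σ ∈ S, FeedforwardRegulation.HasDistinctImaginaryEigenvalues
      (FeedforwardRegulation.companion (a σ)))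
    (hstab : FeedforwardRegulation.IsStabilizable p.A p.B)
    (hreg : ∀ σ ∈ S, ∃ X U, p.IsRegulatorSolution (a σ) X U) :
    (∀ k₁ k₂ : ℝ, 0 < k₁ → 0 < k₂ →
      ∃ g : FeedforwardRegulation.Design nx n, g.k₁ = k₁ ∧ g.k₂ = k₂ ∧ g.IsAdmissible p) ∧
    ∀ g : FeedforwardRegulation.Design nx n, g.IsAdmissible p →
      FeedforwardRegulation.SolvesOutputRegulation p g S a := by
  refine ⟨fun k₁ k₂ h₁ h₂ => ?_, fun g hg σ hσ => ⟨?_, fun s hs hy => ?_⟩⟩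
  · obtain ⟨K, hK⟩ := hstab
    obtain ⟨m, hm⟩ := FeedforwardRegulation.exists_isHurwitz_companion (2 * n)
    exact ⟨⟨m, K, k₁, k₂⟩, rfl, rfl, ⟨hm, hK, h₁, h₂⟩⟩
  · exact FeedforwardRegulation.exists_closedLoopSolution p g (a σ)
  · exact FeedforwardRegulation.closedLoop_regulation hg (hreg σ hσ) hs hy
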